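/- Let $d,n\in\mathbb N$ with $n\ge 1$, let $x_1,\dots,x_n\in\mathbb R^d$ be points with labels $y_1,\dots,y_n\in\{-1,1\}$, let $\ell:\mathbb R\to[0,\infty)$ be a nondecreasing loss function, $r:\mathbb R^d\to[0,\infty)$ a regularizer, $\lambda>0$, and $R=\max_i\|x_i\|_2$. For $\beta\in\mathbb R^d$ put $$f_i(\beta)=\ell(-y_i\,\beta\cdot x_i)+\frac{\lambda\, r(R\beta)}{n},$$ so that $\sum_{i=1}^n f_i(\beta)=F(\beta)=\sum_{i=1}^n\ell(-y_i\,\beta\cdot x_i)+\lambda\, r(R\beta)$ is the objective. A finite collection $C$ of indices from $\{1,\dots,n\}$ (repetitions allowed) with weights $u_i\ge 0$ $(i\in C)$ is an $\varepsilon$-coreset if for all $\beta\in\mathbb R^d$ $$\frac{\bigl|\sum_{i=1}^n f_i(\beta)-\sum_{i\in C}u_if_i(\beta)\bigr|}{\sum_{i=1}^n f_i(\beta)}\le\varepsilon .$$ A finite set $A\subset\mathbb R^d$ is shatterable by $\ell$ if for every $B\subseteq A$ there are $\beta\in\mathbb R^d$ and $t\in\mathbb R$ with $\ell(\beta\cdot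 x)\ge t$ for $x\in B$ and $\ell(\beta\cdot x)<t$ for $x\in A\setminus B$; the VC-dimension of $\ell$ (on $\mathbb R^d$) is the maximum cardinality of a shatterable set. Let $\sigma\ge 0$ and $\tau>0$ be such that $\ell$ and $r$ satisfy the $(\sigma,\tau)$-scaling condition: $\ell(-\sigma)>0$, and $r(\beta)\ge\tau\,\ell(\|\beta\|_2)$ for all $\beta\in\mathbb R^d$ with $\|\beta\|_2\ge\sigma$. Suppose that $\ell$ has VC-dimension at most $\Delta\in\mathbb N$, let $\varepsilon,\delta\in(0,1)$, and set $$S'=\frac{n}{\tau\lambda}+\frac{\ell(\sigma)}{\ell(-\sigma)}+1,\qquad q=\frac{10S'}{\varepsilon^2}\Bigl(\Delta\log S'+\log\frac1\delta\Bigr).$$ Then for every integer $m\ge q$, a sample of $m$ indices drawn independently and uniformly at random from $\{1,\dots,n\}$, each given the weight $n/m$, is an $\varepsilon$-coreset with probability at least $1-\delta$. -/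

import Mathlib

open MeasureTheory

noncomputable section

/-- An instance of the regularized loss minimization problem: `n` points in `ℝ^d` with labels
in `{-1, 1}`, a nonnegative nondecreasing loss `loss`, a nonnegative regularizer `reg` and a
regularization parameter `lam > 0`. -/
structure RLMInstance (d n : ℕ) where
  x : Fin n → EuclideanSpace ℝ (Fin d)
  y : Fin n → ℝ
  y_label : ∀ i, y i = -1 ∨ y i = 1
  loss : ℝ → ℝ
  loss_nonneg : ∀ z, 0 ≤ loss z
  loss_mono : Monotone loss
  reg : EuclideanSpace ℝ (Fin d) → ℝ
  reg_nonneg : ∀ β, 0 ≤ reg β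
  lam : ℝ
  lam_pos : 0 < lam

/-- The maximum Euclidean norm of a data point. -/
def RLMInstance.R {d n : ℕ} [NeZero n] (I : RLMInstance d n) : ℝ :=
  Finset.univ.sup' Finset.univ_nonempty (fun i : Fin n => ‖I.x i‖)

/-- `f_i(β) = ℓ(-y_i β·x_i) + λ r(Rβ) / n`, the contribution of point `i` to the objective
`F(β) = ∑ i, ℓ(-y_i β·x_i) + λ r(Rβ)`. -/
def RLMInstance.f {d n : ℕ} [NeZero n] (I : RLMInstance d n) (i : Fin n)
    (β : EuclideanSpace ℝ (Fin d)) : ℝ :=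
  I.loss (-I.y i * inner ℝ β (I.x i)) + I.lam * I.reg (I.R • β) / n

/-- The relative error `H(β)` of a weighted subcollection, given as a list `C` of `m` indices
(repetitions allowed) with weights `u`. -/
def RLMInstance.relError {d n m : ℕ} [NeZero n] (I : RLMInstance d n) (C : Fin m → Fin n)
    (u : Fin m → ℝ) (β : EuclideanSpace ℝ (Fin d)) : ℝ :=
  |∑ i, I.f i β - ∑ j, u j * I.f (C j) β| / ∑ i, I.f i β

/-- `(C, u)` is an `ε`-coreset of the instance. -/
def RLMInstance.IsCoreset {d n m : ℕ} [NeZero n] (I : RLMInstance d n) (ε : ℝ)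
    (C : Fin m → Fin n) (u : Fin m → ℝ) : Prop :=
  (∀ j, 0 ≤ u j) ∧ ∀ β, I.relError C u β ≤ ε

/-- A finite set `A` of points of `ℝ^d` is shatterable by the loss: every labelling (`B` is the
set of positively labelled points) is realized by some hypothesis and some threshold. -/
def LossShatters {d : ℕ} (loss : ℝ → ℝ) (A : Finset (EuclideanSpace ℝ (Fin d))) : Prop :=
  ∀ B ⊆ A, ∃ (β : EuclideanSpace ℝ (Fin d)) (t : ℝ),
    ∀ x ∈ A, (x ∈ B → t ≤ loss (inner ℝ β x)) ∧ (x ∉ B → loss (inner ℝ β x) < t)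

/-- The VC-dimension of a loss function on `ℝ^d`. -/
def lossVCDim (d : ℕ) (loss : ℝ → ℝ) : ℕ∞ :=
  ⨆ (A : Finset (EuclideanSpace ℝ (Fin d))) (_ : LossShatters loss A), (A.card : ℕ∞)

/-- The `(σ, τ)`-scaling condition. -/
def ScalingCondition {d : ℕ} (loss : ℝ → ℝ) (reg : EuclideanSpace ℝ (Fin d) → ℝ)
    (σ τ : ℝ) : Prop :=
  0 < loss (-σ) ∧ ∀ β : EuclideanSpace ℝ (Fin d), σ ≤ ‖β‖ → τ * loss ‖β‖ ≤ reg β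

/-- The law of `m` i.i.d. uniform draws from the `n` indices. -/
def uniformSample (n m : ℕ) [NeZero n] : Measure (Fin m → Fin n) :=
  Measure.pi (fun _ : Fin m => (PMF.uniformOfFintype (Fin n)).toMeasure)

end

open Finset

/-! The weights `n / m` sum to `n`, so the regularizer cancels in the error and only the sum of the
losses has to be estimated. At a fixed `β` the losses lie in some `[lo, hi]`, and each is `lo` plus
the integral over `t` of the indicator that it is at least `t`. Hence it suffices that every
superlevel set `A` satisfies `|count A - m p| ≤ ε m (ν + p)` with `p = |A| / n`. Integration over
`[lo, hi]` turns `ν` into `ν (hi - lo)` (`abs_sum_sub_le_of_superlevel`), and the scaling condition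
makes `n ν (hi - lo)` at most `n lo + λ r(Rβ)` when `0 ≤ ν` and `ν (S' - 2) ≤ 1`
(`exists_loss_bounds`).

The superlevel sets form a family of VC dimension at most `Δ`. Symmetrization with a ghost sample
(`card_deviating_le`) reduces the uniform deviation bound to random signs on `m` pairs, for the
process `a * signedCount - ε / 2 * |A|`. Its negative drift absorbs the subgaussian variance, which
is proportional to `|A|`, so every set costs the same `exp (-ε² m ν / (1 + ε/2)²)`.

For `ε ≥ 1/4` a Sauer–Shelah union bound then suffices. For small `ε` it would lose a factor of
order `log (1/ε)`, because it counts about `(m/D)^D` traces. There the family is chained through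
nets whose cardinality does not depend on `m` (`log_card_le_of_separated`,
`expMajorized_of_chaining`). -/

/-! ### Sauer–Shelah counting. -/

/-- The partial row sums of Pascal's triangle satisfy `∑_{i ≤ D} C(k, i) ≤ (e k / D) ^ D`. -/
theorem sum_choose_le_exp_mul_div_pow {k D : ℕ} (hD : 1 ≤ D) (hDk : D ≤ k) :
    ((∑ i ∈ Iic D, k.choose i : ℕ) : ℝ) ≤ (Real.exp 1 * k / D) ^ D := by
  have hD0 : (0 : ℝ) < D := by exact_mod_cast hD
  have hk0 : (0 : ℝ) < k := by exact_mod_cast hD.trans hDk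
  -- The bound comes from `r ^ D ≤ r ^ i` for `i ≤ D` and the binomial theorem; `r = D / k` makes
  -- `(1 + r) ^ k ≤ exp D`.
  set r : ℝ := D / k with hr
  have hr0 : 0 < r := by positivity
  have hr1 : r ≤ 1 := by
    rw [hr, div_le_one hk0]; exact_mod_cast hDk
  have h1 : ((∑ i ∈ Iic D, k.choose i : ℕ) : ℝ) * r ^ D ≤ (1 + r) ^ k := by
    rw [add_comm, add_pow, Nat.cast_sum, sum_mul]
    refine (sum_le_sum (f := fun i => ((k.choose i : ℕ) : ℝ) * r ^ D)
      (g := fun i => r ^ i * 1 ^ (k - i) * (k.choose i)) ?_).trans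
      (sum_le_sum_of_subset_of_nonneg ?_ ?_)
    · intro i hi
      have := pow_le_pow_of_le_one hr0.le hr1 (mem_Iic.1 hi)
      rw [one_pow, mul_one, mul_comm]
      gcongr
    · intro i hi
      have := mem_Iic.1 hi
      exact mem_range.2 (by omega)
    · intro i _ _
      positivity
  have h2 : (1 + r) ^ k ≤ Real.exp 1 ^ D := by
    calc (1 + r) ^ k ≤ (Real.exp r) ^ k := by
          gcongr
          linarith [Real.add_one_le_exp r]
      _ = Real.exp 1 ^ D := by
          rw [← Real.exp_nat_mul, ← Real.exp_nat_mul, hr]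
          congr 1
          field_simp
  have h3 : (Real.exp 1 * k / D) ^ D = Real.exp 1 ^ D / r ^ D := by
    rw [← div_pow, hr]
    congr 1
    field_simp
  rw [h3, le_div_iff₀ (by positivity)]
  exact h1.trans h2

/-- The family of preimages under `φ` of the members of a set family. -/
def Finset.comapFamily {ι κ : Type*} [Fintype ι] [DecidableEq ι] [DecidableEq κ] (φ : ι → κ)
    (𝒜 : Finset (Finset κ)) : Finset (Finset ι) :=
  𝒜.image fun A => univ.filter fun i => φ i ∈ A

/-- Preimages never separate two indices with the same image, so `φ` is injective on a shattered set
and its image is shattered by `𝒜`. -/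
theorem Finset.vcDim_comapFamily_le {ι κ : Type*} [Fintype ι] [DecidableEq ι] [DecidableEq κ]
    (φ : ι → κ) (𝒜 : Finset (Finset κ)) : (comapFamily φ 𝒜).vcDim ≤ 𝒜.vcDim := by
  refine Finset.sup_le fun s hs => ?_
  rw [mem_shatterer] at hs
  have hinj : Set.InjOn φ s := by
    intro a ha b hb hab
    obtain ⟨u, hu, hsu⟩ := hs (singleton_subset_iff.2 ha)
    obtain ⟨A, -, rfl⟩ := mem_image.1 hu
    have h1 : a ∈ s ∩ univ.filter fun i => φ i ∈ A := by rw [hsu]; simp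
    have h2 : b ∈ s ∩ univ.filter fun i => φ i ∈ A := by
      simp only [mem_inter, mem_filter, mem_univ, true_and] at h1 ⊢
      exact ⟨hb, hab ▸ h1.2⟩
    rw [hsu] at h2
    exact (mem_singleton.1 h2).symm
  rw [← card_image_of_injOn hinj]
  apply Shatters.card_le_vcDim
  intro t ht
  obtain ⟨u, hu, hsu⟩ := hs (filter_subset (fun i => φ i ∈ t) s)
  obtain ⟨A, hA, rfl⟩ := mem_image.1 hu
  refine ⟨A, hA, ?_⟩
  have key : ∀ i ∈ s, (φ i ∈ A ↔ φ i ∈ t) := by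
    intro i hi
    have := congrArg (i ∈ ·) hsu
    simpa [hi] using this
  ext x
  simp only [mem_inter, mem_image]
  constructor
  · rintro ⟨⟨i, hi, rfl⟩, hx⟩
    exact (key i hi).1 hx
  · intro hx
    obtain ⟨i, hi, rfl⟩ := mem_image.1 (ht hx)
    exact ⟨⟨i, hi, rfl⟩, (key i hi).2 hx⟩

/-- The Sauer-Shelah bound in the form `|𝒜| ≤ (e |ι| / D) ^ D`. -/
theorem Finset.card_le_exp_mul_div_pow {ι : Type*} [Fintype ι] [DecidableEq ι]
    {𝒜 : Finset (Finset ι)} {D : ℕ} (h𝒜 : 𝒜.vcDim ≤ D) (hD : 1 ≤ D)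
    (hDι : D ≤ Fintype.card ι) :
    (#𝒜 : ℝ) ≤ (Real.exp 1 * Fintype.card ι / D) ^ D := by
  refine le_trans ?_ (sum_choose_le_exp_mul_div_pow hD hDι)
  exact_mod_cast (card_le_card_shatterer 𝒜).trans (card_shatterer_le_sum_vcDim.trans
    (sum_le_sum_of_subset (Iic_subset_Iic.2 h𝒜)))

/-! ### Packing numbers of families of bounded VC dimension. -/

/-- If `|𝒩|² (1 - ρ)^k` is small, then `k` points separate all members of a `ρ`-separated family. -/
theorem Finset.exists_injOn_preimage_of_separated {J : Type*} [Fintype J] [DecidableEq J]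
    [Nonempty J] {𝒩 : Finset (Finset J)} {ρ : ℝ}
    (hsep : ∀ A ∈ 𝒩, ∀ B ∈ 𝒩, A ≠ B → ρ * Fintype.card J < #(symmDiff A B)) {k : ℕ}
    (hk : 2 * Real.log #𝒩 ≤ ρ * k) (h𝒩 : 𝒩.Nonempty) :
    ∃ φ : Fin k → J, Set.InjOn (fun A : Finset J => univ.filter fun i => φ i ∈ A) 𝒩 := by
  classical
  by_contra! hcon
  have hN : (0 : ℝ) < #𝒩 := by exact_mod_cast h𝒩.card_pos
  have hJ : (0 : ℝ) < Fintype.card J := by exact_mod_cast Fintype.card_pos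
  -- The tuples missing the symmetric difference of a pair are a fraction at most `exp (-ρ k) ≤
  -- |𝒩|⁻²` of all tuples, and there are fewer than `|𝒩|²` ordered pairs of distinct members.
  let bad : Finset J × Finset J → Finset (Fin k → J) := fun p =>
    Fintype.piFinset fun _ => (symmDiff p.1 p.2)ᶜ
  have hcover : (univ : Finset (Fin k → J)) ⊆ 𝒩.offDiag.biUnion bad := by
    intro φ _
    have h := hcon φ
    simp only [Set.InjOn, not_forall] at h
    obtain ⟨A, hA, B, hB, hAB, hne⟩ := h
    refine mem_biUnion.2 ⟨(A, B), mem_offDiag.2 ⟨hA, hB, hne⟩, ?_⟩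
    simp only [bad, Fintype.mem_piFinset, mem_compl, mem_symmDiff]
    intro i
    have := congrArg (i ∈ ·) hAB
    simp only [mem_filter, mem_univ, true_and, eq_iff_iff] at this
    tauto
  have hbad : ∀ p ∈ 𝒩.offDiag, (#(bad p) : ℝ) ≤
      (Fintype.card J : ℝ) ^ k * ((#𝒩 : ℝ) ^ 2)⁻¹ := by
    rintro ⟨A, B⟩ hp
    obtain ⟨hA, hB, hne⟩ := mem_offDiag.1 hp
    have h1 : (#((symmDiff A B)ᶜ) : ℝ) ≤ Fintype.card J * Real.exp (-ρ) := by
      have h2 : (#((symmDiff A B)ᶜ) : ℝ) = Fintype.card J - #(symmDiff A B) := by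
        rw [card_compl, Nat.cast_sub (card_le_univ _)]
      have h3 := hsep A hA B hB hne
      have h4 := Real.add_one_le_exp (-ρ)
      nlinarith
    have h5 : (#(bad (A, B)) : ℝ) = (#((symmDiff A B)ᶜ) : ℝ) ^ k := by
      simp [bad, Fintype.card_piFinset]
    rw [h5]
    calc (#((symmDiff A B)ᶜ) : ℝ) ^ k ≤ (Fintype.card J * Real.exp (-ρ)) ^ k := by gcongr
      _ = (Fintype.card J : ℝ) ^ k * Real.exp (-(ρ * k)) := by
          rw [mul_pow, ← Real.exp_nat_mul]; congr 2; ring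
      _ ≤ _ := by
          gcongr
          rw [← Real.exp_log (by positivity : (0 : ℝ) < ((#𝒩 : ℝ) ^ 2)⁻¹), Real.log_inv,
            Real.log_pow]
          refine Real.exp_le_exp.2 ?_
          push_cast
          linarith
  have h6 : (Fintype.card J : ℝ) ^ k ≤ #(𝒩.offDiag) *
      ((Fintype.card J : ℝ) ^ k * ((#𝒩 : ℝ) ^ 2)⁻¹) := by
    have h7 := (card_le_card hcover).trans card_biUnion_le
    rw [card_univ, Fintype.card_fun, Fintype.card_fin] at h7
    calc (Fintype.card J : ℝ) ^ k ≤ ∑ p ∈ 𝒩.offDiag, (#(bad p) : ℝ) := by exact_mod_cast h7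
      _ ≤ ∑ p ∈ 𝒩.offDiag, (Fintype.card J : ℝ) ^ k * ((#𝒩 : ℝ) ^ 2)⁻¹ := sum_le_sum hbad
      _ = _ := by rw [sum_const, nsmul_eq_mul]
  have h8 : (#(𝒩.offDiag) : ℝ) < (#𝒩 : ℝ) ^ 2 := by
    rw [offDiag_card]
    have : #𝒩 * #𝒩 - #𝒩 < #𝒩 * #𝒩 := Nat.sub_lt (by positivity) h𝒩.card_pos
    rw [sq]
    exact_mod_cast this
  have h9 : (0 : ℝ) < (Fintype.card J : ℝ) ^ k * ((#𝒩 : ℝ) ^ 2)⁻¹ := by positivity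
  have h10 : (#𝒩 : ℝ) ^ 2 * ((Fintype.card J : ℝ) ^ k * ((#𝒩 : ℝ) ^ 2)⁻¹)
      = (Fintype.card J : ℝ) ^ k := by field_simp
  nlinarith

/-- A packing bound: a family of VC dimension at most `D` that is `ρ`-separated in the normalized
Hamming metric has at most `(13 / ρ) ^ (6 D / 5)` members. -/
theorem Finset.log_card_le_of_separated {J : Type*} [Fintype J] [DecidableEq J] [Nonempty J]
    {𝒩 : Finset (Finset J)} {ρ : ℝ} (hρ : 0 < ρ) (hρ1 : ρ ≤ 1 / 10)
    (hsep : ∀ A ∈ 𝒩, ∀ B ∈ 𝒩, A ≠ B → ρ * Fintype.card J < #(symmDiff A B))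
    {D : ℕ} (hD : 1 ≤ D) (hvc : 𝒩.vcDim ≤ D) :
    Real.log #𝒩 ≤ 6 / 5 * D * Real.log (13 / ρ) := by
  have hD0 : (0 : ℝ) < D := by exact_mod_cast hD
  have hlog : 0 ≤ Real.log (13 / ρ) := Real.log_nonneg (by rw [le_div_iff₀ hρ]; linarith)
  rcases 𝒩.eq_empty_or_nonempty with rfl | h𝒩
  · simp; positivity
  have hN1 : (1 : ℝ) ≤ #𝒩 := by exact_mod_cast h𝒩.card_pos
  have hN : (0 : ℝ) < #𝒩 := by linarith
  have hlN : 0 ≤ Real.log #𝒩 := Real.log_nonneg hN1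
  set y := Real.log #𝒩 / D with hy
  have hyl : Real.log #𝒩 = D * y := by rw [hy]; field_simp
  -- The ceiling gives separation; the extra `D` ensures `D ≤ k`, as the Sauer–Shelah bound
  -- requires.
  set k := ⌈2 * Real.log #𝒩 / ρ⌉₊ + D with hkdef
  have hk1 : 2 * Real.log #𝒩 ≤ ρ * k := by
    have := Nat.le_ceil (2 * Real.log #𝒩 / ρ)
    rw [div_le_iff₀ hρ] at this
    rw [hkdef]; push_cast; nlinarith
  have hk2 : (k : ℝ) ≤ D * (2 * y / ρ + 2) := by
    have h1 := (Nat.ceil_lt_add_one (a := 2 * Real.log #𝒩 / ρ) (by positivity)).le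
    have h2 : (1 : ℝ) ≤ D := by exact_mod_cast hD
    have h3 : 2 * Real.log #𝒩 / ρ = D * (2 * y / ρ) := by rw [hyl]; ring
    rw [hkdef]; push_cast; nlinarith
  obtain ⟨φ, hφ⟩ := exists_injOn_preimage_of_separated hsep hk1 h𝒩
  have hcard : #𝒩 = #(comapFamily φ 𝒩) := (card_image_of_injOn hφ).symm
  have h1 : (#𝒩 : ℝ) ≤ (Real.exp 1 * k / D) ^ D := by
    have := card_le_exp_mul_div_pow ((vcDim_comapFamily_le φ 𝒩).trans hvc) hD
      (by rw [Fintype.card_fin]; omega)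
    rwa [← hcard, Fintype.card_fin] at this
  have h2 : Real.exp 1 * k / D ≤ Real.exp 1 * (2 * y / ρ + 2) := by
    rw [div_le_iff₀ hD0]
    nlinarith [Real.exp_pos 1]
  have h3 : Real.exp y ≤ Real.exp 1 * (2 * y / ρ + 2) := by
    have h4 : Real.exp y ^ D ≤ (Real.exp 1 * k / D) ^ D := by
      rw [← Real.exp_nat_mul, ← hyl, Real.exp_log hN]; exact h1
    exact (le_of_pow_le_pow_left₀ (by omega) (by positivity) h4).trans h2
  have hy0 : 0 ≤ y := by positivity
  -- The self-referential bound `exp y ≤ e (2y/ρ + 2)` is solved by giving up the factor `exp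
  -- (y/6)`, which dominates the linear term; this is the source of the exponent `6/5`.
  set z := Real.exp (y / 6) with hz
  have hz1 : 1 ≤ z := Real.one_le_exp (by positivity)
  have h5 : Real.exp 1 * y ≤ 6 * z := by
    have h6 := Real.add_one_le_exp (y / 6 - 1)
    rw [Real.exp_sub, ← hz] at h6
    have h7 : y / 6 ≤ z / Real.exp 1 := by linarith
    rw [le_div_iff₀ (Real.exp_pos 1)] at h7
    linarith
  have h8 : Real.exp y = z * Real.exp (5 / 6 * y) := by
    rw [hz, ← Real.exp_add]; congr 1; ring
  have h9 : Real.exp (5 / 6 * y) ≤ 13 / ρ := by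
    have h10 : z * Real.exp (5 / 6 * y) ≤ z * (13 / ρ) := by
      rw [← h8]
      refine h3.trans ?_
      have h11 : Real.exp 1 * (2 * y / ρ + 2) = (2 * (Real.exp 1 * y) + 2 * Real.exp 1 * ρ) / ρ := by
        field_simp
      rw [h11, show z * (13 / ρ) = z * 13 / ρ by ring]
      refine div_le_div_of_nonneg_right ?_ hρ.le
      have := Real.exp_one_lt_d9
      nlinarith [Real.exp_pos 1]
    exact le_of_mul_le_mul_left h10 (by linarith)
  have h12 : 5 / 6 * y ≤ Real.log (13 / ρ) := by
    rw [Real.le_log_iff_exp_le (by positivity)]; exact h9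
  rw [hyl]
  nlinarith

/-- Every family has a maximal separated subfamily, which is a net for it. -/
theorem Finset.exists_separated_net {J : Type*} [DecidableEq J] (𝒯 : Finset (Finset J)) {r : ℝ}
    (hr : 0 ≤ r) : ∃ 𝒩 ⊆ 𝒯, (∀ A ∈ 𝒩, ∀ B ∈ 𝒩, A ≠ B → r < #(symmDiff A B)) ∧
      ∀ A ∈ 𝒯, ∃ B ∈ 𝒩, (#(symmDiff A B) : ℝ) ≤ r := by
  classical
  let 𝒮 := 𝒯.powerset.filter fun 𝒩 => ∀ A ∈ 𝒩, ∀ B ∈ 𝒩, A ≠ B → r < (#(symmDiff A B) : ℝ)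
  have hne : 𝒮.Nonempty := ⟨∅, by simp [𝒮]⟩
  obtain ⟨𝒩, h𝒩, hmax⟩ := exists_max_image 𝒮 card hne
  obtain ⟨hsub, hsep⟩ := mem_filter.1 h𝒩
  rw [mem_powerset] at hsub
  refine ⟨𝒩, hsub, hsep, fun A hA => ?_⟩
  by_contra! hcon
  have hA𝒩 : A ∉ 𝒩 := fun h => by
    have := hcon A h
    simp at this
    linarith
  have hins : insert A 𝒩 ∈ 𝒮 := by
    refine mem_filter.2 ⟨mem_powerset.2 (insert_subset hA hsub), ?_⟩
    intro B hB C hC hBC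
    rcases mem_insert.1 hB with rfl | hB' <;> rcases mem_insert.1 hC with rfl | hC'
    · exact absurd rfl hBC
    · exact hcon C hC'
    · rw [symmDiff_comm]; exact hcon B hB'
    · exact hsep B hB' C hC' hBC
  have := hmax _ hins
  rw [card_insert_of_notMem hA𝒩] at this
  omega

/-! ### Exponential moments of signed counts. -/

/-- The sign attached to a Boolean. -/
def boolSign (b : Bool) : ℝ := if b then 1 else -1

/-- Rademacher sums are subgaussian. -/
theorem sum_exp_boolSign_le {m : ℕ} (t : ℝ) (c : Fin m → ℝ) :
    ∑ s : Fin m → Bool, Real.exp (t * ∑ j, boolSign (s j) * c j) ≤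
      2 ^ m * Real.exp (t ^ 2 / 2 * ∑ j, c j ^ 2) := by
  have h1 : ∀ s : Fin m → Bool, Real.exp (t * ∑ j, boolSign (s j) * c j) =
      ∏ j, Real.exp (t * (boolSign (s j) * c j)) := by
    intro s; rw [mul_sum, Real.exp_sum]
  simp_rw [h1]
  rw [← Fintype.prod_sum (fun (j : Fin m) (b : Bool) => Real.exp (t * (boolSign b * c j)))]
  have h2 : (2 : ℝ) ^ m * Real.exp (t ^ 2 / 2 * ∑ j, c j ^ 2) =
      ∏ j : Fin m, 2 * Real.exp ((t * c j) ^ 2 / 2) := by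
    rw [prod_mul_distrib, prod_const, card_univ, Fintype.card_fin, ← Real.exp_sum, mul_sum]
    congr 2
    exact sum_congr rfl fun j _ => by ring
  rw [h2]
  refine prod_le_prod (fun j _ => sum_nonneg fun b _ => (Real.exp_pos _).le) fun j _ => ?_
  rw [Fintype.sum_bool]
  have h3 := Real.cosh_le_exp_half_sq (t * c j)
  rw [Real.cosh_eq] at h3
  simp only [boolSign, if_true, Bool.false_eq_true, if_false, one_mul, neg_mul, mul_neg]
  linarith

/-- The indicator of membership as a real number. -/
def memInd {α : Type*} [DecidableEq α] (A : Finset α) (a : α) : ℝ := if a ∈ A then 1 else 0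

theorem card_eq_sum_memInd {m : ℕ} (A : Finset (Fin m × Bool)) :
    (#A : ℝ) = ∑ j, (memInd A (j, true) + memInd A (j, false)) := by
  have h : (#A : ℝ) = ∑ p : Fin m × Bool, memInd A p := by
    simp [memInd]
  rw [h, Fintype.sum_prod_type]
  exact sum_congr rfl fun j _ => by rw [Fintype.sum_bool]

/-- For a set `A` of elements of `m` pairs: the number of pair members in `A` chosen by `s` minus
the number of those rejected. -/
def signedCount {m : ℕ} (s : Fin m → Bool) (A : Finset (Fin m × Bool)) : ℝ :=
  ∑ j, boolSign (s j) * (memInd A (j, true) - memInd A (j, false))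

/-- A pair with both members in `A` cancels, so the squared coefficients sum to at most `|A|`. -/
theorem sum_exp_signedCount_le {m : ℕ} (t : ℝ) (A : Finset (Fin m × Bool)) :
    ∑ s : Fin m → Bool, Real.exp (t * signedCount s A) ≤
      2 ^ m * Real.exp (t ^ 2 / 2 * #A) := by
  refine (sum_exp_boolSign_le t _).trans ?_
  rw [card_eq_sum_memInd A]
  gcongr with j
  unfold memInd
  split_ifs <;> norm_num

theorem sum_exp_signedCount_sub_le {m : ℕ} (t : ℝ) (A B : Finset (Fin m × Bool)) :
    ∑ s : Fin m → Bool, Real.exp (t * (signedCount s A - signedCount s B)) ≤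
      2 ^ m * Real.exp (t ^ 2 * #(symmDiff A B)) := by
  have h1 : ∀ s : Fin m → Bool, signedCount s A - signedCount s B = ∑ j, boolSign (s j) *
      ((memInd A (j, true) - memInd A (j, false)) - (memInd B (j, true) - memInd B (j, false))) := by
    intro s
    rw [signedCount, signedCount, ← sum_sub_distrib]
    exact sum_congr rfl fun j _ => by ring
  simp_rw [h1]
  refine (sum_exp_boolSign_le t _).trans ?_
  have h2 : ∑ j : Fin m, ((memInd A (j, true) - memInd A (j, false)) -
      (memInd B (j, true) - memInd B (j, false))) ^ 2 ≤ 2 * #(symmDiff A B) := by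
    rw [card_eq_sum_memInd (symmDiff A B), mul_sum]
    refine sum_le_sum fun j _ => ?_
    have h3 : ∀ p, (memInd A p - memInd B p) ^ 2 = memInd (symmDiff A B) p := by
      intro p
      unfold memInd
      simp only [mem_symmDiff]
      by_cases hA : p ∈ A <;> by_cases hB : p ∈ B <;> simp [hA, hB]
    rw [← h3, ← h3]
    nlinarith [sq_nonneg ((memInd A (j, true) - memInd B (j, true)) +
      (memInd A (j, false) - memInd B (j, false)))]
  refine mul_le_mul_of_nonneg_left (Real.exp_le_exp.2 ?_) (by positivity)
  nlinarith [sq_nonneg t]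

/-! ### Chaining in exponential form. -/

/-- Jensen's inequality for a weighted telescoping sum in the exponent. -/
theorem exp_sum_le_sum_exp (q Y : ℕ → ℝ) (hq : ∀ k, 0 < q k) (u : ℝ) (K : ℕ) :
    Real.exp (u / (∑ k ∈ range (K + 1), (q k)⁻¹) * ∑ k ∈ range (K + 1), Y k) ≤
      (∑ k ∈ range (K + 1), (q k)⁻¹)⁻¹ *
        ∑ k ∈ range (K + 1), (q k)⁻¹ * Real.exp (u * q k * Y k) := by
  set W := ∑ k ∈ range (K + 1), (q k)⁻¹ with hW
  have hW0 : 0 < W := sum_pos (fun k _ => inv_pos.2 (hq k)) ⟨0, by simp⟩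
  have h := convexOn_exp.map_sum_le (t := range (K + 1)) (w := fun k => W⁻¹ * (q k)⁻¹)
    (p := fun k => u * q k * Y k) (fun k _ => by have := hq k; positivity)
    (by rw [← mul_sum, ← hW]; field_simp) (fun k _ => Set.mem_univ _)
  simp only [smul_eq_mul] at h
  have h1 : u / W * ∑ k ∈ range (K + 1), Y k =
      ∑ k ∈ range (K + 1), W⁻¹ * (q k)⁻¹ * (u * q k * Y k) := by
    rw [mul_sum]
    refine sum_congr rfl fun k _ => ?_
    have := hq k
    field_simp
  rw [h1]
  refine h.trans (le_of_eq ?_)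
  rw [mul_sum]
  exact sum_congr rfl fun k _ => by ring

/-- The exponent of level `k` of a chain: the value at the base point for `k = 0`, and the
increment of the `k`-th link otherwise, minus the allowance `ℓ k`. -/
def chainLevel {α : Type*} (f : α → ℝ) (π : ℕ → α → α) (ℓ : ℕ → ℝ) : ℕ → α → ℝ
  | 0, B => f B - ℓ 0
  | k + 1, B => f B - f (π k B) - ℓ (k + 1)

/-- Following the projections `π` down from `A` telescopes `f A`; the chain is the same for all `f`
and `ℓ`, hence for all sign choices. -/
theorem exists_chain {α : Type*} {𝒩 : ℕ → Finset α} {π : ℕ → α → α}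
    (hπ : ∀ k, ∀ B ∈ 𝒩 (k + 1), π k B ∈ 𝒩 k) (K : ℕ) {A : α} (hA : A ∈ 𝒩 K) :
    ∃ c : ℕ → α, (∀ k ≤ K, c k ∈ 𝒩 k) ∧ ∀ (f : α → ℝ) (ℓ : ℕ → ℝ),
      f A - ∑ k ∈ range (K + 1), ℓ k = ∑ k ∈ range (K + 1), chainLevel f π ℓ k (c k) := by
  induction K generalizing A with
  | zero =>
    refine ⟨fun _ => A, fun k hk => ?_, fun f ℓ => ?_⟩
    · obtain rfl : k = 0 := by omega
      exact hA
    · simp [chainLevel]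
  | succ K ih =>
    obtain ⟨c, hc, hsum⟩ := ih (hπ K A hA)
    refine ⟨fun k => if k ≤ K then c k else A, fun k hk => ?_, fun f ℓ => ?_⟩
    · by_cases h : k ≤ K
      · simpa [h] using hc k h
      · obtain rfl : k = K + 1 := by omega
        simpa using hA
    · rw [sum_range_succ _ (K + 1), sum_range_succ (fun k => chainLevel f π ℓ k _) (K + 1)]
      have h1 : ∑ k ∈ range (K + 1), chainLevel f π ℓ k (if k ≤ K then c k else A) =
          ∑ k ∈ range (K + 1), chainLevel f π ℓ k (c k) := by
        refine sum_congr rfl fun k hk => ?_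
        have : k ≤ K := by have := mem_range.1 hk; omega
        simp [this]
      rw [h1, ← hsum f ℓ]
      simp only [chainLevel, Nat.not_succ_le_self, if_false]
      ring

/-- A chaining bound for the exponential of a function on the finest net. -/
theorem exp_le_chain_sum {α : Type*} {𝒩 : ℕ → Finset α} {π : ℕ → α → α}
    (hπ : ∀ k, ∀ B ∈ 𝒩 (k + 1), π k B ∈ 𝒩 k) (K : ℕ) {q : ℕ → ℝ} (hq : ∀ k, 0 < q k)
    {u : ℝ} (hu : 0 ≤ u) (f : α → ℝ) (ℓ : ℕ → ℝ) {L : ℝ} (hL : ∑ k ∈ range (K + 1), ℓ k ≤ L)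
    {A : α} (hA : A ∈ 𝒩 K) :
    Real.exp (u / (∑ k ∈ range (K + 1), (q k)⁻¹) * (f A - L)) ≤
      (∑ k ∈ range (K + 1), (q k)⁻¹)⁻¹ * ∑ k ∈ range (K + 1), (q k)⁻¹ *
        ∑ B ∈ 𝒩 k, Real.exp (u * q k * chainLevel f π ℓ k B) := by
  have hW0 : 0 < ∑ k ∈ range (K + 1), (q k)⁻¹ :=
    sum_pos (fun k _ => inv_pos.2 (hq k)) ⟨0, by simp⟩
  obtain ⟨c, hc, hsum⟩ := exists_chain hπ K hA
  calc Real.exp (u / (∑ k ∈ range (K + 1), (q k)⁻¹) * (f A - L))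
      ≤ Real.exp (u / (∑ k ∈ range (K + 1), (q k)⁻¹) *
          ∑ k ∈ range (K + 1), chainLevel f π ℓ k (c k)) := by
        rw [← hsum f ℓ]
        gcongr
    _ ≤ _ := exp_sum_le_sum_exp q (fun k => chainLevel f π ℓ k (c k)) hq u K
    _ ≤ _ := by
        gcongr with k hk
        · exact (inv_pos.2 (hq k)).le
        · exact single_le_sum (f := fun B => Real.exp (u * q k * chainLevel f π ℓ k B))
            (fun B _ => (Real.exp_pos _).le) (hc k (by have := mem_range.1 hk; omega))

/-- The random quantity attached to a set of pair members by the choice `s`. -/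
noncomputable def tiltedCount {m : ℕ} (a ε : ℝ) (s : Fin m → Bool) (A : Finset (Fin m × Bool)) : ℝ :=
  a * signedCount s A - ε / 2 * #A

/-- At the tilt `u = ε / a₀²` the variance term `u² a² |B| / 2` is at most the drift `u ε |B| / 2`,
so the size of `B` disappears. -/
theorem sum_exp_tiltedCount_le {m : ℕ} {a a₀ ε : ℝ} (ha₀ : 0 < a₀) (ha : |a| ≤ a₀)
    (ℓ : ℝ) (B : Finset (Fin m × Bool)) :
    ∑ s : Fin m → Bool, Real.exp (ε / a₀ ^ 2 * (tiltedCount a ε s B - ℓ)) ≤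
      2 ^ m * Real.exp (-(ε / a₀ ^ 2 * ℓ)) := by
  set u := ε / a₀ ^ 2 with hu
  have hsq : a ^ 2 ≤ a₀ ^ 2 := sq_le_sq' (by linarith [neg_abs_le a]) ((le_abs_self a).trans ha)
  have hua : u * a₀ ^ 2 = ε := by rw [hu]; field_simp
  calc ∑ s : Fin m → Bool, Real.exp (u * (tiltedCount a ε s B - ℓ))
      = Real.exp (-(u * (ε / 2 * #B)) - u * ℓ) *
          ∑ s : Fin m → Bool, Real.exp (u * a * signedCount s B) := by
        rw [mul_sum]
        refine sum_congr rfl fun s _ => ?_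
        rw [← Real.exp_add, tiltedCount]
        congr 1
        ring
    _ ≤ Real.exp (-(u * (ε / 2 * #B)) - u * ℓ) *
          (2 ^ m * Real.exp ((u * a) ^ 2 / 2 * #B)) := by
        gcongr
        exact sum_exp_signedCount_le _ _
    _ = 2 ^ m * Real.exp (-(u * (ε / 2 * #B)) - u * ℓ + (u * a) ^ 2 / 2 * #B) := by
        rw [Real.exp_add]; ring
    _ ≤ _ := by
        gcongr
        have h1 : (u * a) ^ 2 ≤ u * ε := by
          rw [← hua, mul_pow]
          nlinarith [sq_nonneg u]
        have h2 : (0 : ℝ) ≤ #B := by positivity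
        nlinarith

/-- For a link the drift may have the wrong sign, but like the variance it is controlled by the
symmetric difference. -/
theorem sum_exp_tiltedCount_sub_le {m : ℕ} {a a₀ ε v r : ℝ} (hε : 0 ≤ ε) (hv : 0 ≤ v)
    (ha : |a| ≤ a₀) (ℓ : ℝ) {A B : Finset (Fin m × Bool)} (hr : (#(symmDiff A B) : ℝ) ≤ r) :
    ∑ s : Fin m → Bool, Real.exp (v * (tiltedCount a ε s A - tiltedCount a ε s B - ℓ)) ≤
      2 ^ m * Real.exp (v ^ 2 * a₀ ^ 2 * r + v * ε / 2 * r - v * ℓ) := by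
  have hsq : a ^ 2 ≤ a₀ ^ 2 := sq_le_sq' (by linarith [neg_abs_le a]) ((le_abs_self a).trans ha)
  have hcard : (#B : ℝ) ≤ #A + #(symmDiff A B) := by
    have h : B ⊆ A ∪ symmDiff A B := fun x hx => by
      by_cases hA : x ∈ A <;> simp [mem_symmDiff, hA, hx]
    exact_mod_cast (card_le_card h).trans (card_union_le _ _)
  calc ∑ s : Fin m → Bool, Real.exp (v * (tiltedCount a ε s A - tiltedCount a ε s B - ℓ))
      = Real.exp (v * ε / 2 * (#B - #A) - v * ℓ) *
          ∑ s : Fin m → Bool, Real.exp (v * a * (signedCount s A - signedCount s B)) := by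
        rw [mul_sum]
        refine sum_congr rfl fun s _ => ?_
        rw [← Real.exp_add, tiltedCount, tiltedCount]
        congr 1
        ring
    _ ≤ Real.exp (v * ε / 2 * (#B - #A) - v * ℓ) *
          (2 ^ m * Real.exp ((v * a) ^ 2 * #(symmDiff A B))) := by
        gcongr
        exact sum_exp_signedCount_sub_le _ _ _
    _ = 2 ^ m * Real.exp (v * ε / 2 * (#B - #A) - v * ℓ +
          (v * a) ^ 2 * #(symmDiff A B)) := by
        rw [Real.exp_add]; ring
    _ ≤ _ := by
        gcongr
        have h1 : (v * a) ^ 2 * #(symmDiff A B) ≤ v ^ 2 * a₀ ^ 2 * r := by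
          rw [mul_pow]; gcongr
        have h2 : v * ε / 2 * ((#B : ℝ) - #A) ≤ v * ε / 2 * r := by
          gcongr
          linarith
        linarith

/-- For every set family of VC dimension at most `D` on `m` pairs, the exponentials of the tilted
counts have a common majorant with mean at most `η` over the choices `s`. -/
def ExpMajorized (m D : ℕ) (ε ν η : ℝ) : Prop :=
  ∃ Λ : ℝ, 0 < Λ ∧ ∀ 𝒯 : Finset (Finset (Fin m × Bool)), 𝒯.vcDim ≤ D →
    ∀ a : ℝ, |a| ≤ 1 + ε / 2 → ∃ G : (Fin m → Bool) → ℝ,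
      (∀ s, ∀ A ∈ 𝒯, Real.exp (Λ * (tiltedCount a ε s A - ε * m * ν)) ≤ G s) ∧
        ∑ s, G s ≤ η * 2 ^ m

/-- The majorant given by a union bound over the whole family. -/
theorem expMajorized_of_card {m D : ℕ} {ε ν η : ℝ} (hε : 0 < ε) (hD : 1 ≤ D) (hDm : D ≤ 2 * m)
    (hη : (Real.exp 1 * (2 * m) / D) ^ D * Real.exp (-(ε ^ 2 * m * ν / (1 + ε / 2) ^ 2)) ≤ η) :
    ExpMajorized m D ε ν η := by
  refine ⟨ε / (1 + ε / 2) ^ 2, by positivity, fun 𝒯 h𝒯 a ha => ⟨fun s => ∑ A ∈ 𝒯,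
    Real.exp (ε / (1 + ε / 2) ^ 2 * (tiltedCount a ε s A - ε * m * ν)), fun s A hA => ?_, ?_⟩⟩
  · exact single_le_sum (f := fun A =>
      Real.exp (ε / (1 + ε / 2) ^ 2 * (tiltedCount a ε s A - ε * m * ν)))
      (fun B _ => (Real.exp_pos _).le) hA
  · have hJ : Fintype.card (Fin m × Bool) = 2 * m := by simp [mul_comm]
    have hcard := card_le_exp_mul_div_pow h𝒯 hD (by rw [hJ]; exact hDm)
    rw [hJ] at hcard
    push_cast at hcard
    rw [sum_comm]
    calc _ ≤ ∑ A ∈ 𝒯, (2 : ℝ) ^ m * Real.exp (-(ε / (1 + ε / 2) ^ 2 * (ε * m * ν))) :=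
          sum_le_sum fun A _ => sum_exp_tiltedCount_le (by positivity) ha _ A
      _ = #𝒯 * Real.exp (-(ε ^ 2 * m * ν / (1 + ε / 2) ^ 2)) * 2 ^ m := by
          rw [sum_const, nsmul_eq_mul]
          ring_nf
      _ ≤ (Real.exp 1 * (2 * m) / D) ^ D *
            Real.exp (-(ε ^ 2 * m * ν / (1 + ε / 2) ^ 2)) * 2 ^ m := by gcongr
      _ ≤ _ := by gcongr

/-- The exponent gained by a link of a chain, for geometrically decreasing radii and allowances. -/
theorem link_exponent_le (k : ℕ) {ε M ν a₀ : ℝ} (hM : 0 < M) (hν : 0 < ν)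
    (ha₀ : 0 < a₀) :
    (ε / a₀ ^ 2 * (20 * 16 ^ k)) ^ 2 * a₀ ^ 2 * (M * ν / (250 * 64 ^ k)) +
      ε / a₀ ^ 2 * (20 * 16 ^ k) * ε / 2 * (M * ν / (250 * 64 ^ k)) -
      ε / a₀ ^ 2 * (20 * 16 ^ k) * (3 / 20 * (ε * M * ν) * (1 / 4) ^ k) ≤
    -(34 / 25 * (1 + 3 * k) * (ε ^ 2 * M * ν / a₀ ^ 2)) := by
  have h4 : (1 : ℝ) + 3 * k ≤ 4 ^ k := by
    have := one_add_mul_le_pow (by norm_num : (-2 : ℝ) ≤ 3) k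
    norm_num at this
    linarith
  have h1 : (1 : ℝ) ≤ 4 ^ k := one_le_pow₀ (by norm_num)
  have h16 : (16 : ℝ) ^ k = (4 ^ k) ^ 2 := by rw [← pow_mul, mul_comm k, pow_mul]; norm_num
  have h64 : (64 : ℝ) ^ k = (4 ^ k) ^ 3 := by rw [← pow_mul, mul_comm k, pow_mul]; norm_num
  rw [h16, h64, div_pow, one_pow]
  generalize (4 : ℝ) ^ k = x at *
  have hx : 0 < x := by linarith
  set Q := ε ^ 2 * M * ν / a₀ ^ 2 with hQ
  have hQ0 : 0 ≤ Q := by positivity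
  have e : (ε / a₀ ^ 2 * (20 * x ^ 2)) ^ 2 * a₀ ^ 2 * (M * ν / (250 * x ^ 3)) +
      ε / a₀ ^ 2 * (20 * x ^ 2) * ε / 2 * (M * ν / (250 * x ^ 3)) -
      ε / a₀ ^ 2 * (20 * x ^ 2) * (3 / 20 * (ε * M * ν) * (1 / x)) =
      (8 / 5 * x + 1 / 25 * (1 / x) - 3 * x) * Q := by
    rw [hQ]
    field_simp
    ring
  have h5 : 1 / x ≤ x := by rw [div_le_iff₀ hx]; nlinarith
  rw [e]
  nlinarith

/-- The size of a separated subfamily at the `k`-th radius of the chain. -/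
theorem card_le_of_separated_radius {m D : ℕ} {ν : ℝ} (hm : 1 ≤ m) (hD : 1 ≤ D) (hν : 0 < ν)
    (hν3 : ν ≤ 3) (k : ℕ) {𝒩 : Finset (Finset (Fin m × Bool))} (hvc : 𝒩.vcDim ≤ D)
    (hsep : ∀ A ∈ 𝒩, ∀ B ∈ 𝒩, A ≠ B → m * ν / (250 * 64 ^ k) < #(symmDiff A B)) :
    (#𝒩 : ℝ) ≤ Real.exp (6 / 5 * D * Real.log (6500 / ν) + 5 * k * D) := by
  have : Nonempty (Fin m × Bool) := ⟨(⟨0, hm⟩, true)⟩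
  have hlog64 : Real.log 64 ≤ 4.16 := by
    rw [show (64 : ℝ) = 2 ^ 6 by norm_num, Real.log_pow]
    have := Real.log_two_lt_d9
    push_cast
    linarith
  have h64 : (1 : ℝ) ≤ 64 ^ k := one_le_pow₀ (by norm_num)
  have h1 := log_card_le_of_separated (𝒩 := 𝒩) (ρ := ν / (500 * 64 ^ k)) (by positivity)
    (by rw [div_le_div_iff₀ (by positivity) (by norm_num)]; nlinarith)
    (fun A hA B hB hne => by
      refine lt_of_eq_of_lt ?_ (hsep A hA B hB hne)
      simp only [Fintype.card_prod, Fintype.card_fin, Fintype.card_bool]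
      push_cast
      field_simp
      norm_num) hD hvc
  have h2 : Real.log (13 / (ν / (500 * 64 ^ k))) =
      Real.log (6500 / ν) + k * Real.log 64 := by
    rw [← Real.log_pow, ← Real.log_mul (by positivity) (by positivity)]
    congr 1
    field_simp
    norm_num
  rw [h2] at h1
  rcases 𝒩.eq_empty_or_nonempty with h0 | h0
  · rw [h0]
    simp only [card_empty, Nat.cast_zero]
    positivity
  · rw [← Real.log_le_iff_le_exp (by exact_mod_cast h0.card_pos)]
    refine h1.trans ?_
    have : (k : ℝ) * D * Real.log 64 ≤ k * D * 4.16 := by gcongr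
    nlinarith [(by positivity : (0 : ℝ) ≤ k * D)]

/-- The majorant given by chaining. -/
theorem expMajorized_of_chaining {m D : ℕ} {ε ν η : ℝ} (hm : 1 ≤ m) (hε : 0 < ε) (hD : 1 ≤ D)
    (hν : 0 < ν) (hν3 : ν ≤ 3) (hη : 0 < η) (hη1 : η ≤ 1)
    (hQ : 6 / 5 * D * Real.log (6500 / ν) + Real.log (1 / η) ≤
      4 / 5 * (ε ^ 2 * m * ν / (1 + ε / 2) ^ 2)) :
    ExpMajorized m D ε ν η := by
  classical
  have hm0 : (0 : ℝ) < m := by exact_mod_cast hm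
  have hD0 : (1 : ℝ) ≤ D := by exact_mod_cast hD
  have ha₀ : 0 < 1 + ε / 2 := by positivity
  set a₀ := 1 + ε / 2 with ha₀def
  set Q := ε ^ 2 * m * ν / a₀ ^ 2 with hQdef
  set u := ε / a₀ ^ 2 with hudef
  have hu : 0 < u := by positivity
  have huQ : u * (ε * m * ν) = Q := by rw [hudef, hQdef]; ring
  have hQ0 : 0 < Q := by positivity
  have hlogη : 0 ≤ Real.log (1 / η) := Real.log_nonneg (by rw [le_div_iff₀ hη]; linarith)
  -- Radii shrink by 64, tilts grow by 16 and allowances shrink by 4 per level. A link then gains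
  -- order `4 ^ k * Q`, which beats the logarithm of the net size, linear in `k`. The allowances sum
  -- to at most `ε m ν (4/5 + 1/5)`.
  set r : ℕ → ℝ := fun k => m * ν / (250 * 64 ^ k) with hr
  set q : ℕ → ℝ := fun k => Nat.casesOn k 1 (fun k => 20 * 16 ^ k) with hq
  have hq0 : q 0 = 1 := rfl
  have hqs : ∀ k, q (k + 1) = 20 * 16 ^ k := fun k => rfl
  have hqpos : ∀ k, 0 < q k := by
    rintro (_ | k)
    · rw [hq0]; norm_num
    · rw [hqs]; positivity
  set ℓ : ℕ → ℝ := fun k => Nat.casesOn k (4 / 5 * (ε * m * ν))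
    (fun k => 3 / 20 * (ε * m * ν) * (1 / 4) ^ k) with hℓ
  have hℓ0 : ℓ 0 = 4 / 5 * (ε * m * ν) := rfl
  have hℓs : ∀ k, ℓ (k + 1) = 3 / 20 * (ε * m * ν) * (1 / 4) ^ k := fun k => rfl
  have hrpos : ∀ k, 0 < r k := fun k => by simp only [hr]; positivity
  -- Below radius 1 distinct sets cannot be close, so the net at level `K` is the whole family.
  obtain ⟨K, hK⟩ : ∃ K, r K < 1 := by
    obtain ⟨K, hK⟩ := pow_unbounded_of_one_lt (m * ν) (by norm_num : (1 : ℝ) < 64)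
    refine ⟨K, ?_⟩
    simp only [hr]
    rw [div_lt_one (by positivity)]
    have : (0 : ℝ) < 64 ^ K := by positivity
    linarith
  have hlog7 : 7 ≤ Real.log (6500 / ν) := by
    have h1 : Real.log (2 ^ 11) ≤ Real.log (6500 / ν) := by
      apply Real.log_le_log (by norm_num)
      rw [le_div_iff₀ hν]
      linarith
    rw [Real.log_pow] at h1
    have := Real.log_two_gt_d9
    push_cast at h1
    linarith
  have hQD : 10 * D ≤ Q := by nlinarith
  set W := ∑ k ∈ range (K + 1), (q k)⁻¹ with hW
  have hW0 : 0 < W := sum_pos (fun k _ => inv_pos.2 (hqpos k)) ⟨0, by simp⟩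
  refine ⟨u / W, by positivity, fun 𝒯 h𝒯 a ha => ?_⟩
  choose 𝒩 h𝒩sub h𝒩sep h𝒩net using fun k => exists_separated_net 𝒯 (hrpos k).le
  have hpi : ∀ k, ∀ A, ∃ B, A ∈ 𝒯 → B ∈ 𝒩 k ∧ (#(symmDiff A B) : ℝ) ≤ r k := by
    intro k A
    by_cases hA : A ∈ 𝒯
    · obtain ⟨B, hB, hAB⟩ := h𝒩net k A hA
      exact ⟨B, fun _ => ⟨hB, hAB⟩⟩
    · exact ⟨∅, fun h => absurd h hA⟩
  choose π hπ using hpi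
  have hπmem : ∀ k, ∀ B ∈ 𝒩 (k + 1), π k B ∈ 𝒩 k := fun k B hB =>
    (hπ k B (h𝒩sub _ hB)).1
  have hfine : ∀ A ∈ 𝒯, A ∈ 𝒩 K := by
    intro A hA
    obtain ⟨B, hB, hAB⟩ := h𝒩net K A hA
    have h0 : #(symmDiff A B) < 1 := by exact_mod_cast hAB.trans_lt hK
    have h1 : symmDiff A B = ∅ := card_eq_zero.1 (by omega)
    have h2 : A = B := symmDiff_eq_bot.1 h1
    exact h2 ▸ hB
  have hL : ∑ k ∈ range (K + 1), ℓ k ≤ ε * m * ν := by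
    rw [sum_range_succ', hℓ0]
    simp_rw [hℓs]
    rw [← mul_sum]
    have h1 : ∑ k ∈ range K, (1 / 4 : ℝ) ^ k ≤ 4 / 3 := by
      have h0 : (0 : ℝ) ≤ (1 / 4) ^ K := by positivity
      have h3 := geom_sum_eq (by norm_num : (1 / 4 : ℝ) ≠ 1) K
      have h5 : ((1 / 4 : ℝ) ^ K - 1) / (1 / 4 - 1) = 4 / 3 * (1 - (1 / 4) ^ K) := by ring
      rw [h3, h5]
      linarith
    have h2 : 0 < ε * m * ν := by positivity
    nlinarith
  have hNcard : ∀ k, (#(𝒩 k) : ℝ) ≤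
      Real.exp (6 / 5 * D * Real.log (6500 / ν) + 5 * k * D) := fun k =>
    card_le_of_separated_radius hm hD hν hν3 k ((vcDim_mono (h𝒩sub k)).trans h𝒯) (h𝒩sep k)
  have hηexp : η = Real.exp (-Real.log (1 / η)) := by
    rw [one_div, Real.log_inv, neg_neg, Real.exp_log hη]
  have hlevel : ∀ k, ∑ s : Fin m → Bool, ∑ B ∈ 𝒩 k,
      Real.exp (u * q k * chainLevel (tiltedCount a ε s) π ℓ k B) ≤ η * 2 ^ m := by
    intro k
    obtain ⟨E, hE1, hE2⟩ : ∃ E : ℝ, (∀ B ∈ 𝒩 k, ∑ s : Fin m → Bool,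
        Real.exp (u * q k * chainLevel (tiltedCount a ε s) π ℓ k B) ≤ 2 ^ m * Real.exp E) ∧
        6 / 5 * D * Real.log (6500 / ν) + 5 * k * D + E ≤ -Real.log (1 / η) := by
      rcases k with _ | k
      · refine ⟨-(u * ℓ 0), fun B _ => ?_, ?_⟩
        · rw [hq0, mul_one]
          exact sum_exp_tiltedCount_le ha₀ ha _ B
        · have : u * ℓ 0 = 4 / 5 * Q := by rw [hℓ0, ← huQ]; ring
          rw [this]
          push_cast
          linarith
      · refine ⟨_, fun B hB => sum_exp_tiltedCount_sub_le hε.le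
          (mul_pos hu (hqpos (k + 1))).le ha _ (hπ k B (h𝒩sub _ hB)).2, ?_⟩
        have h4 := link_exponent_le k (ε := ε) hm0 hν ha₀
        have h8 : (k : ℝ) * (10 * D) ≤ k * Q := by gcongr
        have h9 : 0 ≤ (k : ℝ) * Q := by positivity
        rw [hqs, hℓs]
        refine (add_le_add_right h4 _).trans ?_
        push_cast
        linarith
    rw [sum_comm]
    calc _ ≤ ∑ B ∈ 𝒩 k, (2 : ℝ) ^ m * Real.exp E := sum_le_sum hE1
      _ = #(𝒩 k) * (2 ^ m * Real.exp E) := by rw [sum_const, nsmul_eq_mul]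
      _ ≤ Real.exp (6 / 5 * D * Real.log (6500 / ν) + 5 * k * D) * (2 ^ m * Real.exp E) := by
          gcongr
          exact hNcard k
      _ = Real.exp (6 / 5 * D * Real.log (6500 / ν) + 5 * k * D + E) * 2 ^ m := by
          rw [Real.exp_add _ E]; ring
      _ ≤ Real.exp (-Real.log (1 / η)) * 2 ^ m := by gcongr
      _ = η * 2 ^ m := by rw [← hηexp]
  -- The weights `W⁻¹ * (q k)⁻¹` sum to 1, so the bound `η * 2 ^ m` of each level passes to the
  -- majorant without loss.
  refine ⟨fun s => W⁻¹ * ∑ k ∈ range (K + 1), (q k)⁻¹ *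
    ∑ B ∈ 𝒩 k, Real.exp (u * q k * chainLevel (tiltedCount a ε s) π ℓ k B),
    fun s A hA => exp_le_chain_sum hπmem K hqpos hu.le _ ℓ hL (hfine A hA), ?_⟩
  rw [← mul_sum, sum_comm]
  simp_rw [← mul_sum]
  calc _ ≤ W⁻¹ * ∑ k ∈ range (K + 1), (q k)⁻¹ * (η * 2 ^ m) := by
        gcongr with k hk
        · exact (inv_pos.2 (hqpos k)).le
        · exact hlevel k
    _ = η * 2 ^ m := by
        rw [← sum_mul, ← hW]
        field_simp

/-! ### Symmetrization. -/

/-- The number of draws of the sample `C` that fall into `A`. -/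
def sampleCount {n m : ℕ} (C : Fin m → Fin n) (A : Finset (Fin n)) : ℝ := ∑ j, memInd A (C j)

theorem sum_sampleCount {n : ℕ} [NeZero n] (m : ℕ) (A : Finset (Fin n)) :
    ∑ C : Fin m → Fin n, sampleCount C A = (n : ℝ) ^ m * (m * (#A / n)) := by
  have hn : (n : ℝ) ≠ 0 := by exact_mod_cast NeZero.ne n
  simp only [sampleCount]
  rw [sum_comm]
  have h : ∀ j : Fin m, ∑ C : Fin m → Fin n, memInd A (C j) = (n : ℝ) ^ m * (#A / n) := by
    intro j
    have h1 := Fintype.sum_piFinset_apply (memInd A) univ j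
    rw [Fintype.piFinset_univ] at h1
    have h2 : ∑ b, memInd A b = #A := by simp [memInd]
    obtain ⟨k, rfl⟩ : ∃ k, m = k + 1 := ⟨m - 1, by have := j.2; omega⟩
    rw [h1, h2, card_univ, Fintype.card_fin, Fintype.card_fin, nsmul_eq_mul, Nat.add_sub_cancel,
      pow_succ]
    push_cast
    field_simp
  rw [sum_congr rfl fun j _ => h j, sum_const, card_univ, Fintype.card_fin, nsmul_eq_mul]
  ring

/-- Splitting a double sample into the chosen and the rejected members of each pair. -/
def splitEquiv {κ : Type*} {m : ℕ} (s : Fin m → Bool) :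
    (Fin m × Bool → κ) ≃ (Fin m → κ) × (Fin m → κ) where
  toFun φ := (fun j => φ (j, s j), fun j => φ (j, !s j))
  invFun p := fun x => if x.2 = s x.1 then p.1 x.1 else p.2 x.1
  left_inv φ := by
    funext ⟨j, b⟩
    by_cases h : b = s j
    · simp [h]
    · have h' : b = !s j := by cases b <;> cases hs : s j <;> simp_all
      simp [h']
  right_inv p := by
    ext j <;> simp

/-- With chosen count `X` and rejected count `Y`, `e X - (e + ε) Y = (e + ε/2) (X - Y) - (ε/2) (X +
Y)`. -/
theorem sampleCount_sub_eq_tiltedCount {n m : ℕ} (e ε : ℝ) (s : Fin m → Bool)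
    (φ : Fin m × Bool → Fin n) (A : Finset (Fin n)) :
    e * sampleCount (fun j => φ (j, s j)) A - (e + ε) * sampleCount (fun j => φ (j, !s j)) A =
      tiltedCount (e + ε / 2) ε s (univ.filter fun p => φ p ∈ A) := by
  rw [tiltedCount, signedCount, card_eq_sum_memInd, sampleCount, sampleCount, mul_sum, mul_sum,
    mul_sum, mul_sum, ← sum_sub_distrib, ← sum_sub_distrib]
  refine sum_congr rfl fun j _ => ?_
  have h : ∀ p, memInd (univ.filter fun p => φ p ∈ A) p = memInd A (φ p) := fun p => by
    simp [memInd]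
  simp only [h]
  cases s j <;> simp [boolSign] <;> ring

/-- Symmetrization: a common exponential majorant on double samples bounds the number of samples
with a large one-sided relative deviation on some member of the family. -/
theorem card_deviating_le {n m D : ℕ} [NeZero n] {𝓕 : Finset (Finset (Fin n))}
    (h𝓕ne : 𝓕.Nonempty) (h𝓕 : 𝓕.vcDim ≤ D) {ε ν η e : ℝ} (he : |e + ε / 2| ≤ 1 + ε / 2)
    (hmaj : ExpMajorized m D ε ν η) (Bad : Finset (Fin m → Fin n))
    (hBad : ∀ C ∈ Bad, ∃ A ∈ 𝓕,
      ε * m * (ν + #A / n) ≤ e * (sampleCount C A - m * (#A / n))) :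
    (#Bad : ℝ) ≤ η * (n : ℝ) ^ m := by
  classical
  obtain ⟨A₀, hA₀⟩ := h𝓕ne
  obtain ⟨Λ, hΛ, hmaj⟩ := hmaj
  have hn : (0 : ℝ) < n := by exact_mod_cast NeZero.pos n
  set N : ℝ := (n : ℝ) ^ m with hN
  have hN0 : 0 < N := by positivity
  have hch : ∀ C, ∃ A ∈ 𝓕, C ∈ Bad →
      ε * m * (ν + #A / n) ≤ e * (sampleCount C A - m * (#A / n)) := by
    intro C
    by_cases hC : C ∈ Bad
    · obtain ⟨A, hA, h⟩ := hBad C hC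
      exact ⟨A, hA, fun _ => h⟩
    · exact ⟨A₀, hA₀, fun h => absurd h hC⟩
  -- The witness set depends on the first sample only, so averaging over the ghost sample treats it
  -- as fixed.
  choose W hW𝓕 hW using hch
  let F : (Fin m → Fin n) × (Fin m → Fin n) → ℝ := fun p =>
    Real.exp (Λ * (e * sampleCount p.1 (W p.1) - (e + ε) * sampleCount p.2 (W p.1) - ε * m * ν))
  have hJensen : ∀ C ∈ Bad, N ≤ ∑ C', F (C, C') := by
    intro C hC
    have h1 := convexOn_exp.map_sum_le (t := (univ : Finset (Fin m → Fin n)))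
      (w := fun _ => N⁻¹) (p := fun C' => Λ * (e * sampleCount C (W C) -
        (e + ε) * sampleCount C' (W C) - ε * m * ν)) (fun _ _ => by positivity)
      (by simp [hN, hn.ne']) (fun _ _ => Set.mem_univ _)
    simp only [smul_eq_mul] at h1
    rw [← mul_sum, ← mul_sum, ← mul_sum, sum_sub_distrib, sum_sub_distrib,
      ← mul_sum (s := univ) (f := fun C' => sampleCount C' (W C)),
      sum_sampleCount, sum_const, sum_const, card_univ, Fintype.card_fun, Fintype.card_fin,
      Fintype.card_fin, nsmul_eq_mul, nsmul_eq_mul] at h1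
    push_cast at h1
    rw [← hN] at h1
    have h2 : 1 ≤ Real.exp (N⁻¹ * (Λ * (N * (e * sampleCount C (W C)) -
        (e + ε) * (N * (m * (#(W C) / n))) - N * (ε * m * ν)))) := by
      apply Real.one_le_exp
      have h3 := hW C hC
      have h4 : N⁻¹ * (Λ * (N * (e * sampleCount C (W C)) -
        (e + ε) * (N * (m * (#(W C) / n))) - N * (ε * m * ν))) =
        Λ * (e * (sampleCount C (W C) - m * (#(W C) / n)) - ε * m * (ν + #(W C) / n)) := by
        field_simp
        ring
      rw [h4]
      exact mul_nonneg hΛ.le (by linarith)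
    have h5 := h2.trans h1
    rw [inv_mul_eq_div, le_div_iff₀ hN0, one_mul] at h5
    exact h5
  have h1 : #Bad * N ≤ ∑ p, F p := by
    rw [Fintype.sum_prod_type]
    calc (#Bad : ℝ) * N = ∑ C ∈ Bad, N := by rw [sum_const, nsmul_eq_mul]
      _ ≤ ∑ C ∈ Bad, ∑ C', F (C, C') := sum_le_sum hJensen
      _ ≤ _ := sum_le_sum_of_subset_of_nonneg (subset_univ _) fun C _ _ =>
          sum_nonneg fun C' _ => (Real.exp_pos _).le
  -- Each `s` merely permutes the double samples, so averaging over `s` is free.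
  have h2 : 2 ^ m * ∑ p, F p = ∑ φ : Fin m × Bool → Fin n, ∑ s : Fin m → Bool,
      F (splitEquiv s φ) := by
    rw [sum_comm]
    simp_rw [fun s : Fin m → Bool => (splitEquiv (κ := Fin n) s).sum_comp F]
    rw [sum_const, card_univ, Fintype.card_fun, Fintype.card_fin, Fintype.card_bool, nsmul_eq_mul]
    push_cast
    rfl
  have h3 : ∀ φ : Fin m × Bool → Fin n, ∑ s : Fin m → Bool, F (splitEquiv s φ) ≤ η * 2 ^ m := by
    intro φ
    obtain ⟨G, hG, hGsum⟩ := hmaj (comapFamily φ 𝓕) ((vcDim_comapFamily_le φ 𝓕).trans h𝓕)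
      (e + ε / 2) he
    refine (sum_le_sum fun s _ => ?_).trans hGsum
    refine le_trans (le_of_eq ?_) (hG s _ (mem_image_of_mem _ (hW𝓕 (fun j => φ (j, s j)))))
    simp only [F, splitEquiv, Equiv.coe_fn_mk]
    rw [← sampleCount_sub_eq_tiltedCount]
  have h4 : 2 ^ m * ∑ p, F p ≤ N ^ 2 * (η * 2 ^ m) := by
    rw [h2]
    refine (sum_le_sum fun φ _ => h3 φ).trans (le_of_eq ?_)
    rw [sum_const, card_univ, Fintype.card_fun, Fintype.card_prod, Fintype.card_fin,
      Fintype.card_bool, Fintype.card_fin, nsmul_eq_mul, hN]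
    push_cast
    rw [pow_mul]
  have h5 : ∑ p, F p ≤ N * (η * N) := by
    have : (0 : ℝ) < 2 ^ m := by positivity
    nlinarith
  nlinarith

/-! ### Numerics of the sample size. -/

/-- `log S` increases and `S / (S - 2)` decreases, so on each interval of a subdivision the endpoint
values serve as `l` and `r`. The numbers 11.25 and 7.16 bound `6/5 * log 6500 + log 2` and `log
1280`. -/
theorem exists_log_div_bounds {S : ℝ} (hS : 7 / 3 ≤ S) :
    ∃ l r : ℝ, l ≤ Real.log S ∧ r ≤ S / (S - 2) ∧ 0 ≤ l ∧ 1 ≤ r ∧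
      11.25 ≤ l * (512 / 81 * r - 6 / 5) ∧ 7.16 ≤ l * (71 / 18 * r - 1) := by
  have h2 := Real.log_two_gt_d9
  have h3 := Real.log_three_gt_d9
  have h5 := Real.log_five_gt_d9
  have key : ∀ {s₀ s₁ l : ℝ}, 0 < s₀ → s₀ ≤ S → S ≤ s₁ → l ≤ Real.log s₀ →
      l ≤ Real.log S ∧ s₁ / (s₁ - 2) ≤ S / (S - 2) := by
    intro s₀ s₁ l hs₀ h0 h1 hl
    refine ⟨hl.trans (Real.log_le_log hs₀ h0), ?_⟩
    rw [div_le_div_iff₀ (by linarith) (by linarith)]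
    linarith
  have h6 : Real.log 6 = Real.log 2 + Real.log 3 := by
    rw [← Real.log_mul (by norm_num) (by norm_num)]; norm_num
  have h4 : Real.log 4 = 2 * Real.log 2 := by
    rw [show (4 : ℝ) = 2 ^ 2 by norm_num, Real.log_pow]; norm_num
  have h8 : Real.log 8 = 3 * Real.log 2 := by
    rw [show (8 : ℝ) = 2 ^ 3 by norm_num, Real.log_pow]; norm_num
  have h12 : Real.log 12 = 2 * Real.log 2 + Real.log 3 := by
    rw [← h4, ← Real.log_mul (by norm_num) (by norm_num)]; norm_num
  rcases le_total S 3 with c3 | c3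
  · obtain ⟨a, b⟩ := key (l := 0.6931) (by norm_num : (0 : ℝ) < 2) (by linarith) c3 (by linarith)
    exact ⟨_, _, a, b, by norm_num, by norm_num, by norm_num, by norm_num⟩
  rcases le_total S 4 with c4 | c4
  · obtain ⟨a, b⟩ := key (l := 1.0986) (by norm_num) c3 c4 (by linarith)
    exact ⟨_, _, a, b, by norm_num, by norm_num, by norm_num, by norm_num⟩
  rcases le_total S 5 with c5 | c5
  · obtain ⟨a, b⟩ := key (l := 1.3862) (by norm_num) c4 c5 (by linarith)
    exact ⟨_, _, a, b, by norm_num, by norm_num, by norm_num, by norm_num⟩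
  rcases le_total S 6 with c6 | c6
  · obtain ⟨a, b⟩ := key (l := 1.609) (by norm_num) c5 c6 (by linarith)
    exact ⟨_, _, a, b, by norm_num, by norm_num, by norm_num, by norm_num⟩
  rcases le_total S 8 with c8 | c8
  · obtain ⟨a, b⟩ := key (l := 1.7917) (by norm_num) c6 c8 (by linarith)
    exact ⟨_, _, a, b, by norm_num, by norm_num, by norm_num, by norm_num⟩
  rcases le_total S 12 with c12 | c12
  · obtain ⟨a, b⟩ := key (l := 2.079) (by norm_num) c8 c12 (by linarith)
    exact ⟨_, _, a, b, by norm_num, by norm_num, by norm_num, by norm_num⟩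
  · refine ⟨2.4848, 1, ?_, ?_, by norm_num, le_rfl, by norm_num, by norm_num⟩
    · refine le_trans ?_ (Real.log_le_log (by norm_num) c12)
      linarith
    · rw [le_div_iff₀ (by linarith)]; linarith

/-- The numerical inequalities behind the choice `ν = min 3 (1 / (S - 2))`. -/
theorem min_inv_log_bounds {S ν : ℝ} (hS : 2 < S) (hν : ν = min 3 (1 / (S - 2))) :
    0 < ν ∧ 1 ≤ ν * S ∧
      6 / 5 * Real.log (6500 / ν) + Real.log 2 ≤ 512 / 81 * (ν * S * Real.log S) ∧
      Real.log (1280 / ν) ≤ 71 / 18 * (ν * S * Real.log S) := by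
  have hx : 0 < S - 2 := by linarith
  have h2 := Real.log_two_gt_d9
  have h2' := Real.log_two_lt_d9
  have h3' := Real.log_three_lt_d9
  have h5' := Real.log_five_lt_d9
  rcases le_total S (7 / 3) with hc | hc
  · have hν3 : ν = 3 := by
      rw [hν, min_eq_left]
      rw [le_div_iff₀ hx]; linarith
    have hlog : 0.69 ≤ Real.log S := by
      refine le_trans ?_ (Real.log_le_log (by norm_num) hS.le)
      linarith
    have hb1 : Real.log (6500 / 3) ≤ 12 * Real.log 2 := by
      have := Real.log_le_log (by norm_num) (by norm_num : (6500 / 3 : ℝ) ≤ 2 ^ 12)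
      rw [Real.log_pow] at this
      exact_mod_cast this
    have hb2 : Real.log (1280 / 3) ≤ 9 * Real.log 2 := by
      have := Real.log_le_log (by norm_num) (by norm_num : (1280 / 3 : ℝ) ≤ 2 ^ 9)
      rw [Real.log_pow] at this
      exact_mod_cast this
    have hp : 6 * 0.69 ≤ 3 * S * Real.log S := by nlinarith
    rw [hν3]
    refine ⟨by norm_num, by linarith, by linarith, by linarith⟩
  · have hν1 : ν = 1 / (S - 2) := by
      rw [hν, min_eq_right]
      rw [div_le_iff₀ hx]; linarith
    obtain ⟨l, r, hl, hr, hl0, hr1, hF1, hF2⟩ := exists_log_div_bounds hc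
    have hνS : ν * S = S / (S - 2) := by rw [hν1]; ring
    have hdiv : ∀ c : ℝ, c / ν = c * (S - 2) := fun c => by rw [hν1]; field_simp
    have hlogS : Real.log (S - 2) ≤ Real.log S := Real.log_le_log hx (by linarith)
    have hb1 : Real.log 6500 ≤ 8 * Real.log 3 := by
      have := Real.log_le_log (by norm_num) (by norm_num : (6500 : ℝ) ≤ 3 ^ 8)
      rw [Real.log_pow] at this
      exact_mod_cast this
    have hb2 : Real.log 1280 = 8 * Real.log 2 + Real.log 5 := by
      rw [show (1280 : ℝ) = 2 ^ 8 * 5 by norm_num, Real.log_mul (by norm_num) (by norm_num),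
        Real.log_pow]
      norm_num
    rw [hνS, hdiv, hdiv, Real.log_mul (by norm_num) hx.ne', Real.log_mul (by norm_num) hx.ne']
    generalize S / (S - 2) = w at *
    generalize Real.log S = L at *
    have hA : l * (512 / 81 * r - 6 / 5) ≤ L * (512 / 81 * w - 6 / 5) :=
      mul_le_mul hl (by linarith) (by linarith) (by linarith)
    have hB : l * (71 / 18 * r - 1) ≤ L * (71 / 18 * w - 1) :=
      mul_le_mul hl (by linarith) (by linarith) (by linarith)
    refine ⟨by rw [hν1]; positivity, by linarith, by linarith, by linarith⟩

/-- The sample size of the theorem suffices for an exponential majorant with mean `δ / 2`. -/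
theorem expMajorized_of_sample_size {S ν ε δ : ℝ} {m D : ℕ} (hS : 2 < S)
    (hν : ν = min 3 (1 / (S - 2))) (hD : 1 ≤ D) (hε : ε ∈ Set.Ioo (0 : ℝ) 1)
    (hδ : δ ∈ Set.Ioo (0 : ℝ) 1)
    (hm : 10 * S / ε ^ 2 * (D * Real.log S + Real.log (1 / δ)) ≤ m) :
    ExpMajorized m D ε ν (δ / 2) := by
  obtain ⟨hε0, hε1⟩ := hε
  obtain ⟨hδ0, hδ1⟩ := hδ
  obtain ⟨hν0, hνS, hF1, hF2⟩ := min_inv_log_bounds hS hν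
  have hν3 : ν ≤ 3 := hν ▸ min_le_left _ _
  have hD1 : (1 : ℝ) ≤ D := by exact_mod_cast hD
  have hlogδ : 0 ≤ Real.log (1 / δ) := Real.log_nonneg (by rw [le_div_iff₀ hδ0]; linarith)
  have hlogS : 0.69 ≤ Real.log S := by
    refine le_trans ?_ (Real.log_le_log (by norm_num) hS.le)
    linarith [Real.log_two_gt_d9]
  have hlog2δ : Real.log (1 / (δ / 2)) = Real.log 2 + Real.log (1 / δ) := by
    rw [← Real.log_mul (by norm_num) (by positivity)]
    congr 1
    field_simp
  have hmε : 10 * S * (D * Real.log S + Real.log (1 / δ)) ≤ ε ^ 2 * m := by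
    rw [div_mul_eq_mul_div, div_le_iff₀ (by positivity)] at hm
    linarith
  have hmD : (D : ℝ) ≤ m := by
    have h1 : ε ^ 2 * m ≤ m := by
      exact mul_le_of_le_one_left (Nat.cast_nonneg m) (pow_le_one₀ hε0.le hε1.le)
    have h2 : D * 0.69 ≤ D * Real.log S := by gcongr
    have h3 : 10 * 2 * (D * 0.69) ≤ 10 * S * (D * Real.log S + Real.log (1 / δ)) := by
      gcongr
      linarith
    linarith
  have hmD' : D ≤ m := by exact_mod_cast hmD
  set X := D * (ν * S * Real.log S) + ν * S * Real.log (1 / δ) with hX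
  have hQ : 10 * X ≤ ε ^ 2 * m * ν := by
    have := mul_le_mul_of_nonneg_right hmε hν0.le
    rw [hX]
    linarith
  have hX0 : Real.log (1 / δ) ≤ ν * S * Real.log (1 / δ) :=
    le_mul_of_one_le_left hlogδ hνS
  -- The constants of `min_inv_log_bounds` arise here: `512/81 = 10 * (4/5) * (64/81)` for chaining
  -- and `71/18 = 10 * (4/9 - 1/20)` for the union bound.
  rcases le_total ε (1 / 4) with hc | hc
  · refine expMajorized_of_chaining (hD.trans hmD') hε0 hD hν0 hν3 (by positivity) (by linarith) ?_
    rw [hlog2δ]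
    have hQ2 : 64 / 81 * (ε ^ 2 * m * ν) ≤ ε ^ 2 * m * ν / (1 + ε / 2) ^ 2 := by
      rw [le_div_iff₀ (by positivity)]
      have h1 : (1 + ε / 2) ^ 2 ≤ (9 / 8) ^ 2 := by gcongr; linarith
      have h2 : 0 ≤ ε ^ 2 * m * ν := by positivity
      have h3 := mul_le_mul_of_nonneg_left h1 h2
      linarith
    have h3 := mul_le_mul_of_nonneg_left hF1 (by linarith : (0 : ℝ) ≤ D)
    have h4 : Real.log 2 ≤ D * Real.log 2 :=
      le_mul_of_one_le_left (Real.log_nonneg (by norm_num)) hD1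
    linarith
  · refine expMajorized_of_card hε0 hD (by omega) ?_
    have hm0 : (0 : ℝ) < m := by linarith
    have hQ2 : 4 / 9 * (ε ^ 2 * m * ν) ≤ ε ^ 2 * m * ν / (1 + ε / 2) ^ 2 := by
      rw [le_div_iff₀ (by positivity)]
      have h1 : (1 + ε / 2) ^ 2 ≤ (3 / 2) ^ 2 := by gcongr; linarith
      have h2 : 0 ≤ ε ^ 2 * m * ν := by positivity
      have h3 := mul_le_mul_of_nonneg_left h1 h2
      linarith
    have hlogN : D * Real.log (Real.exp 1 * (2 * m) / D) ≤
        D * Real.log (640 / ν) + ε ^ 2 * m * ν / 20 := by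
      -- Bounding `log Z` by `Z - 1` trades the dependence of `log (m/D)` on `m` for 1/20 of `ε² m
      -- ν`; `ε ≥ 1/4` turns `40 / ε²` into 640.
      set Z := ε ^ 2 * m * ν / D / 20 with hZ
      have hZ0 : 0 < Z := by positivity
      have e1 : Real.exp 1 * (2 * m) / D = Real.exp 1 * (40 / (ε ^ 2 * ν)) * Z := by
        rw [hZ]; field_simp; norm_num
      have h1 : Real.log (40 / (ε ^ 2 * ν)) ≤ Real.log (640 / ν) := by
        apply Real.log_le_log (by positivity)
        rw [div_le_div_iff₀ (by positivity) hν0]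
        have h2 : (1 / 4) ^ 2 ≤ ε ^ 2 := by gcongr
        have h3 := mul_le_mul_of_nonneg_right h2 hν0.le
        linarith
      have h2 := Real.log_le_sub_one_of_pos hZ0
      rw [e1, Real.log_mul (by positivity) hZ0.ne', Real.log_mul (by positivity) (by positivity),
        Real.log_exp]
      have h3 : ε ^ 2 * m * ν / 20 = D * Z := by rw [hZ]; field_simp
      rw [h3, ← mul_add]
      exact mul_le_mul_of_nonneg_left (by linarith) (by linarith)
    have e2 : (Real.exp 1 * (2 * m) / D) ^ D =
        Real.exp (D * Real.log (Real.exp 1 * (2 * m) / D)) := by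
      rw [Real.exp_nat_mul, Real.exp_log (by positivity)]
    have e3 : δ / 2 = Real.exp (-Real.log (1 / (δ / 2))) := by
      rw [one_div, Real.log_inv, neg_neg, Real.exp_log (by positivity)]
    rw [e2, ← Real.exp_add, e3]
    refine Real.exp_le_exp.2 ?_
    rw [hlog2δ]
    have e4 : Real.log (1280 / ν) = Real.log 2 + Real.log (640 / ν) := by
      rw [← Real.log_mul (by norm_num) (by positivity)]
      congr 1
      ring
    have h3 := mul_le_mul_of_nonneg_left hF2 (by linarith : (0 : ℝ) ≤ D)
    rw [e4] at h3
    have h4 : Real.log 2 ≤ D * Real.log 2 :=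
      le_mul_of_one_le_left (Real.log_nonneg (by norm_num)) hD1
    linarith

/-! ### From superlevel sets to losses. -/

theorem integral_indicator_le {lo hi c : ℝ} (h : c ∈ Set.Icc lo hi) :
    ∫ t in lo..hi, (if t ≤ c then (1 : ℝ) else 0) = c - lo := by
  have h1 := intervalIntegral.integral_indicator (μ := volume) (f := fun _ => (1 : ℝ)) h
  simp only [Set.indicator, Set.mem_ofPred_eq] at h1
  rw [h1]
  simp

theorem intervalIntegrable_indicator_le (lo hi c : ℝ) :
    IntervalIntegrable (fun t => if t ≤ c then (1 : ℝ) else 0) volume lo hi := by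
  apply Antitone.intervalIntegrable
  intro a b hab
  by_cases hb : b ≤ c
  · simp [hb, hab.trans hb]
  · by_cases ha : a ≤ c <;> simp [ha, hb]

/-- Relative deviation bounds for all superlevel sets of `v` integrate to one for `v`. -/
theorem abs_sum_sub_le_of_superlevel {n m : ℕ} [NeZero n] (C : Fin m → Fin n) (v : Fin n → ℝ)
    {lo hi ε ν : ℝ} (hv : ∀ i, v i ∈ Set.Icc lo hi)
    (h : ∀ t, |sampleCount C (univ.filter fun i => t ≤ v i) -
      m * (#(univ.filter fun i => t ≤ v i) / n)| ≤
        ε * m * (ν + #(univ.filter fun i => t ≤ v i) / n)) :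
    |∑ j, v (C j) - m / n * ∑ i, v i| ≤ ε * m * (ν * (hi - lo) + 1 / n * (∑ i, v i - n * lo)) := by
  have hn : (n : ℝ) ≠ 0 := by exact_mod_cast NeZero.ne n
  have hlohi : lo ≤ hi := (hv 0).1.trans (hv 0).2
  set ind : Fin n → ℝ → ℝ := fun i t => if t ≤ v i then 1 else 0 with hind
  have hint : ∀ i, IntervalIntegrable (ind i) volume lo hi := fun i =>
    intervalIntegrable_indicator_le _ _ _
  have hval : ∀ i, ∫ t in lo..hi, ind i t = v i - lo := fun i => integral_indicator_le (hv i)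
  have hcount : ∀ t, sampleCount C (univ.filter fun i => t ≤ v i) = ∑ j, ind (C j) t := by
    intro t; simp [sampleCount, memInd, hind]
  have hcard : ∀ t, (#(univ.filter fun i => t ≤ v i) : ℝ) = ∑ i, ind i t := by
    intro t; simp [hind]
  have hsumC : IntervalIntegrable (fun t => ∑ j, ind (C j) t) volume lo hi :=
    ⟨integrable_finsetSum univ fun j _ => (hint (C j)).1,
      integrable_finsetSum univ fun j _ => (hint (C j)).2⟩
  have hsum : IntervalIntegrable (fun t => ∑ i, ind i t) volume lo hi :=
    ⟨integrable_finsetSum univ fun i _ => (hint i).1,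
      integrable_finsetSum univ fun i _ => (hint i).2⟩
  have hIC : ∫ t in lo..hi, ∑ j, ind (C j) t = ∑ j, v (C j) - m * lo := by
    rw [intervalIntegral.integral_finsetSum fun j _ => hint (C j)]
    simp [hval, sum_sub_distrib]
  have hI : ∫ t in lo..hi, ∑ i, ind i t = ∑ i, v i - n * lo := by
    rw [intervalIntegral.integral_finsetSum fun i _ => hint i]
    simp [hval, sum_sub_distrib]
  have key := intervalIntegral.norm_integral_le_of_norm_le (μ := volume) hlohi
    (f := fun t => ∑ j, ind (C j) t - m / n * ∑ i, ind i t)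
    (g := fun t => ε * m * ν + ε * m / n * ∑ i, ind i t)
    (Filter.Eventually.of_forall fun t _ => by
      have := h t
      rw [hcount, hcard] at this
      rw [Real.norm_eq_abs]
      convert this using 1
      · congr 1; ring
      · ring) (intervalIntegrable_const.add (hsum.const_mul _))
  rw [intervalIntegral.integral_sub hsumC (hsum.const_mul _),
    intervalIntegral.integral_add intervalIntegrable_const (hsum.const_mul _),
    intervalIntegral.integral_const_mul (m / n : ℝ),
    intervalIntegral.integral_const_mul (ε * m / n), hIC, hI,
    intervalIntegral.integral_const, Real.norm_eq_abs, smul_eq_mul] at key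
  convert key using 1
  · congr 1
    field_simp
    ring
  · field_simp

/-! ### VC dimension of the losses and the scaling condition. -/

/-- The family of index sets `{i | t ≤ ℓ(-y_i β·x_i)}`. -/
noncomputable def RLMInstance.lossFamily {d n : ℕ} (I : RLMInstance d n) :
    Finset (Finset (Fin n)) := by
  classical
  exact univ.filter fun A => ∃ (β : EuclideanSpace ℝ (Fin d)) (t : ℝ),
    A = univ.filter fun i => t ≤ I.loss (-I.y i * inner ℝ β (I.x i))

theorem RLMInstance.mem_lossFamily {d n : ℕ} (I : RLMInstance d n)
    (β : EuclideanSpace ℝ (Fin d)) (t : ℝ) :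
    (univ.filter fun i => t ≤ I.loss (-I.y i * inner ℝ β (I.x i))) ∈ I.lossFamily := by
  classical
  simp only [lossFamily, mem_filter, mem_univ, true_and]
  exact ⟨β, t, rfl⟩

theorem LossShatters.card_le {d : ℕ} {loss : ℝ → ℝ} {A : Finset (EuclideanSpace ℝ (Fin d))}
    (hA : LossShatters loss A) {D : ℕ} (hD : lossVCDim d loss ≤ D) : #A ≤ D := by
  have h := le_iSup₂ (f := fun (A : Finset (EuclideanSpace ℝ (Fin d)))
    (_ : LossShatters loss A) => (#A : ℕ∞)) A hA
  exact_mod_cast h.trans hD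

/-- The singleton of the origin is always shattered, by moving the threshold. -/
theorem one_le_of_lossVCDim_le {d : ℕ} {loss : ℝ → ℝ} {D : ℕ} (hD : lossVCDim d loss ≤ D) :
    1 ≤ D := by
  have h : LossShatters loss ({0} : Finset (EuclideanSpace ℝ (Fin d))) := by
    intro B _
    by_cases hB : (0 : EuclideanSpace ℝ (Fin d)) ∈ B
    · exact ⟨0, loss 0, by simp [hB]⟩
    · exact ⟨0, loss 0 + 1, by simp [hB]⟩
  simpa using h.card_le hD

/-- The labels are absorbed into the points `-y_i x_i`; these are distinct on a shattered index set,
since singletons can be cut out. -/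
theorem RLMInstance.vcDim_lossFamily_le {d n : ℕ} (I : RLMInstance d n) {D : ℕ}
    (hD : lossVCDim d I.loss ≤ D) : I.lossFamily.vcDim ≤ D := by
  classical
  refine Finset.sup_le fun s hs => ?_
  rw [mem_shatterer] at hs
  let z : Fin n → EuclideanSpace ℝ (Fin d) := fun i => (-I.y i) • I.x i
  have hz : ∀ β i, -I.y i * inner ℝ β (I.x i) = inner ℝ β (z i) := fun β i => by
    simp only [z, inner_smul_right]
  have hs' : ∀ t ⊆ s, ∃ (β : EuclideanSpace ℝ (Fin d)) (c : ℝ),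
      ∀ i ∈ s, c ≤ I.loss (inner ℝ β (z i)) ↔ i ∈ t := by
    intro t ht
    obtain ⟨u, hu, hsu⟩ := hs ht
    simp only [lossFamily, mem_filter, mem_univ, true_and] at hu
    obtain ⟨β, c, rfl⟩ := hu
    refine ⟨β, c, fun i hi => ?_⟩
    rw [← hsu]
    simp [hi, hz]
  have hinj : Set.InjOn z s := by
    intro a ha b hb hab
    obtain ⟨β, c, h⟩ := hs' {a} (singleton_subset_iff.2 ha)
    have h1 := (h a ha).2 (mem_singleton_self a)
    rw [hab] at h1
    exact (mem_singleton.1 ((h b hb).1 h1)).symm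
  rw [← card_image_of_injOn hinj]
  refine LossShatters.card_le (fun B hB => ?_) hD
  obtain ⟨β, c, h⟩ := hs' (s.filter fun i => z i ∈ B) (filter_subset _ _)
  refine ⟨β, c, fun x hx => ?_⟩
  obtain ⟨i, hi, rfl⟩ := mem_image.1 hx
  have := h i hi
  simp only [mem_filter, hi, true_and] at this
  exact ⟨this.2, fun hn => not_le.1 fun hle => hn (this.1 hle)⟩

theorem RLMInstance.norm_le_R {d n : ℕ} [NeZero n] (I : RLMInstance d n) (i : Fin n) :
    ‖I.x i‖ ≤ I.R :=
  le_sup' (fun i : Fin n => ‖I.x i‖) (mem_univ i)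

theorem RLMInstance.abs_margin_le {d n : ℕ} [NeZero n] (I : RLMInstance d n) (i : Fin n)
    (β : EuclideanSpace ℝ (Fin d)) : |-I.y i * inner ℝ β (I.x i)| ≤ ‖I.R • β‖ := by
  have hR : 0 ≤ I.R := (norm_nonneg _).trans (I.norm_le_R 0)
  have hy : |-I.y i| = 1 := by rcases I.y_label i with h | h <;> simp [h]
  rw [abs_mul, hy, one_mul, norm_smul, Real.norm_of_nonneg hR, mul_comm]
  exact (abs_real_inner_le_norm _ _).trans (by gcongr; exact I.norm_le_R i)

/-- Under the scaling condition, all losses at `β` lie in an interval that is short in comparison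
with its lower end plus the regularization. -/
theorem RLMInstance.exists_loss_bounds {d n : ℕ} [NeZero n] (I : RLMInstance d n) {σ τ ν : ℝ}
    (hτ : 0 < τ) (hscale : ScalingCondition I.loss I.reg σ τ) (hν : 0 ≤ ν)
    (h1 : ν * (n / (τ * I.lam)) ≤ 1) (h2 : ν * (I.loss σ / I.loss (-σ) - 1) ≤ 1)
    (β : EuclideanSpace ℝ (Fin d)) :
    ∃ lo hi : ℝ, (∀ i, I.loss (-I.y i * inner ℝ β (I.x i)) ∈ Set.Icc lo hi) ∧
      n * (ν * (hi - lo)) ≤ n * lo + I.lam * I.reg (I.R • β) := by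
  have hn : (0 : ℝ) < n := by exact_mod_cast NeZero.pos n
  have hlam := I.lam_pos
  have hreg := I.reg_nonneg (I.R • β)
  have hmargin := fun i => abs_le.1 (I.abs_margin_le i β)
  -- For large `Rβ` the regularizer pays for `hi`; for small `Rβ` all margins lie in `[-σ, σ]` and
  -- `n lo` pays for the range.
  rcases le_total σ ‖I.R • β‖ with hc | hc
  · refine ⟨I.loss (-‖I.R • β‖), I.loss ‖I.R • β‖,
      fun i => ⟨I.loss_mono (hmargin i).1, I.loss_mono (hmargin i).2⟩, ?_⟩
    have h3 := hscale.2 _ hc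
    have h4 := I.loss_nonneg (-‖I.R • β‖)
    have h5 := I.loss_nonneg ‖I.R • β‖
    generalize I.loss ‖I.R • β‖ = hi at *
    generalize I.loss (-‖I.R • β‖) = lo at *
    have h6 : n * ν * hi ≤ I.lam * I.reg (I.R • β) := by
      have e : n * ν * hi = ν * (n / (τ * I.lam)) * (I.lam * (τ * hi)) := by field_simp
      rw [e]
      have h7 : I.lam * (τ * hi) ≤ I.lam * I.reg (I.R • β) := by gcongr
      have h8 : 0 ≤ I.lam * (τ * hi) := by positivity
      nlinarith
    have h9 : 0 ≤ n * ν * lo := by positivity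
    have h10 : 0 ≤ n * lo := by positivity
    linarith
  · refine ⟨I.loss (-σ), I.loss σ, fun i => ⟨I.loss_mono (by linarith [(hmargin i).1]),
      I.loss_mono (by linarith [(hmargin i).2])⟩, ?_⟩
    have h3 := hscale.1
    have h4 : ν * (I.loss σ - I.loss (-σ)) ≤ I.loss (-σ) := by
      have e : ν * (I.loss σ - I.loss (-σ)) =
          ν * (I.loss σ / I.loss (-σ) - 1) * I.loss (-σ) := by field_simp
      rw [e]
      nlinarith
    have h5 : n * (ν * (I.loss σ - I.loss (-σ))) ≤ n * I.loss (-σ) := by gcongr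
    have h6 : 0 ≤ I.lam * I.reg (I.R • β) := by positivity
    linarith

/-- A sample with small relative deviations on all loss sets is a coreset. -/
theorem RLMInstance.isCoreset_of_deviation_le {d n m : ℕ} [NeZero n] (I : RLMInstance d n)
    {σ τ ν ε : ℝ} (hm : 0 < m) (hτ : 0 < τ) (hscale : ScalingCondition I.loss I.reg σ τ)
    (hν : 0 ≤ ν) (hε : 0 ≤ ε)
    (h1 : ν * (n / (τ * I.lam)) ≤ 1) (h2 : ν * (I.loss σ / I.loss (-σ) - 1) ≤ 1)
    {C : Fin m → Fin n} (hC : ∀ A ∈ I.lossFamily,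
      |sampleCount C A - m * (#A / n)| ≤ ε * m * (ν + #A / n)) :
    I.IsCoreset ε C (fun _ => (n : ℝ) / m) := by
  have hn : (0 : ℝ) < n := by exact_mod_cast NeZero.pos n
  have hm0 : (0 : ℝ) < m := by exact_mod_cast hm
  refine ⟨fun _ => by positivity, fun β => ?_⟩
  obtain ⟨lo, hi, hv, hlohi⟩ := I.exists_loss_bounds hτ hscale hν h1 h2 β
  have key := abs_sum_sub_le_of_superlevel C _ hv fun t => hC _ (I.mem_lossFamily β t)
  have hρ : 0 ≤ I.lam * I.reg (I.R • β) := mul_nonneg I.lam_pos.le (I.reg_nonneg _)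
  set v : Fin n → ℝ := fun i => I.loss (-I.y i * inner ℝ β (I.x i)) with hvdef
  have e1 : ∑ i, I.f i β = ∑ i, v i + I.lam * I.reg (I.R • β) := by
    simp only [RLMInstance.f, sum_add_distrib, sum_const, card_univ, Fintype.card_fin,
      nsmul_eq_mul, hvdef]
    field_simp
  have e2 : ∑ j, (n : ℝ) / m * I.f (C j) β =
      n / m * ∑ j, v (C j) + I.lam * I.reg (I.R • β) := by
    rw [← mul_sum]
    simp only [RLMInstance.f, sum_add_distrib, sum_const, card_univ, Fintype.card_fin,
      nsmul_eq_mul, hvdef]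
    field_simp
  have hv0 : 0 ≤ ∑ i, v i := sum_nonneg fun i _ => I.loss_nonneg _
  rw [RLMInstance.relError, e1, e2]
  -- This also covers a vanishing objective, where the quotient is 0 by convention.
  refine div_le_of_le_mul₀ (by positivity) hε ?_
  have e3 : ∑ i, v i + I.lam * I.reg (I.R • β) -
      (n / m * ∑ j, v (C j) + I.lam * I.reg (I.R • β)) =
      -(n / m) * (∑ j, v (C j) - m / n * ∑ i, v i) := by
    field_simp
    ring
  rw [e3, abs_mul, abs_neg, abs_of_pos (by positivity)]
  calc (n : ℝ) / m * |∑ j, v (C j) - m / n * ∑ i, v i|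
      ≤ n / m * (ε * m * (ν * (hi - lo) + 1 / n * (∑ i, v i - n * lo))) := by gcongr
    _ = ε * (n * (ν * (hi - lo)) + (∑ i, v i - n * lo)) := by field_simp
    _ ≤ ε * (∑ i, v i + I.lam * I.reg (I.R • β)) := by
        exact mul_le_mul_of_nonneg_left (by linarith) hε

/-! ### The uniform sample and the conclusion. -/

instance (n m : ℕ) [NeZero n] : IsProbabilityMeasure (uniformSample n m) := by
  unfold uniformSample
  infer_instance

theorem uniformSample_coe {n m : ℕ} [NeZero n] (s : Finset (Fin m → Fin n)) :
    uniformSample n m s = ENNReal.ofReal (#s / (n : ℝ) ^ m) := by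
  have hn : (0 : ℝ) < n := by exact_mod_cast NeZero.pos n
  have h1 : ∀ C : Fin m → Fin n, uniformSample n m {C} = ((n : ENNReal)⁻¹) ^ m := by
    intro C
    rw [uniformSample, Measure.pi_singleton]
    simp [PMF.uniformOfFintype_apply]
  rw [← sum_measure_singleton]
  simp only [h1, sum_const, nsmul_eq_mul]
  rw [ENNReal.ofReal_div_of_pos (by positivity), ENNReal.ofReal_natCast,
    ENNReal.ofReal_pow hn.le, ENNReal.ofReal_natCast, div_eq_mul_inv, ENNReal.inv_pow]

theorem mainTheorem1 {d n : ℕ} [NeZero n] (I : RLMInstance d n) (σ τ : ℝ)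
    (hσ : 0 ≤ σ) (hτ : 0 < τ) (hscale : ScalingCondition I.loss I.reg σ τ)
    (Δ : ℕ) (hΔ : lossVCDim d I.loss ≤ (Δ : ℕ∞))
    (ε δ : ℝ) (hε : ε ∈ Set.Ioo (0 : ℝ) 1) (hδ : δ ∈ Set.Ioo (0 : ℝ) 1)
    (S' : ℝ) (hS' : S' = n / (τ * I.lam) + I.loss σ / I.loss (-σ) + 1)
    (m : ℕ) (hm : 10 * S' / ε ^ 2 * (Δ * Real.log S' + Real.log (1 / δ)) ≤ m) :
    ENNReal.ofReal (1 - δ) ≤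
      uniformSample n m {C | I.IsCoreset ε C (fun _ => (n : ℝ) / m)} := by
  classical
  have hn : (0 : ℝ) < n := by exact_mod_cast NeZero.pos n
  have hε0 := hε.1
  have hδ0 := hδ.1
  have hΔ1 := one_le_of_lossVCDim_le hΔ
  have ha : 0 < n / (τ * I.lam) := div_pos hn (mul_pos hτ I.lam_pos)
  have hκ : 1 ≤ I.loss σ / I.loss (-σ) := by
    rw [le_div_iff₀ hscale.1, one_mul]
    exact I.loss_mono (by linarith)
  have hS : 2 < S' := by linarith
  have hm0 : 0 < m := by
    have h1 : 0 < Real.log S' := Real.log_pos (by linarith)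
    have h2 : 0 < Real.log (1 / δ) := Real.log_pos (by rw [lt_div_iff₀ hδ0]; linarith [hδ.2])
    have h3 : (0 : ℝ) < m := lt_of_lt_of_le (by positivity) hm
    exact_mod_cast h3
  -- `S' - 2` is the sum of the nonnegative `n / (τλ)` and `ℓ(σ)/ℓ(-σ) - 1`, so `ν (S' - 2) ≤ 1`
  -- handles both cases of the scaling condition. The cap 3 keeps the packing radii small.
  set ν := min 3 (1 / (S' - 2)) with hν
  have hν0 : 0 < ν := (min_inv_log_bounds hS hν).1
  have hν1 : ν * (S' - 2) ≤ 1 := by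
    rw [← le_div_iff₀ (by linarith)]
    exact min_le_right _ _
  have hνa : ν * (n / (τ * I.lam)) ≤ 1 := by nlinarith
  have hνκ : ν * (I.loss σ / I.loss (-σ) - 1) ≤ 1 := by nlinarith
  have hmaj := expMajorized_of_sample_size hS hν hΔ1 hε hδ hm
  have h𝓕ne : I.lossFamily.Nonempty := ⟨_, I.mem_lossFamily 0 0⟩
  have h𝓕 := I.vcDim_lossFamily_le hΔ
  let Bad : ℝ → Finset (Fin m → Fin n) := fun e => univ.filter fun C => ∃ A ∈ I.lossFamily,
    ε * m * (ν + #A / n) ≤ e * (sampleCount C A - m * (#A / n))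
  have hcard : ∀ e : ℝ, |e + ε / 2| ≤ 1 + ε / 2 → (#(Bad e) : ℝ) ≤ δ / 2 * (n : ℝ) ^ m :=
    fun e he => card_deviating_le h𝓕ne h𝓕 he hmaj (Bad e) fun C hC => (mem_filter.1 hC).2
  -- Upper and lower deviations are `e = 1` and `e = -1`, each with failure probability at most `δ /
  -- 2`.
  have hup := hcard 1 (by rw [abs_of_pos (by positivity)])
  have hdown := hcard (-1) (by rw [abs_le]; constructor <;> linarith)
  have hsub : ((Bad 1 ∪ Bad (-1) : Finset (Fin m → Fin n)) : Set (Fin m → Fin n))ᶜ ⊆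
      {C | I.IsCoreset ε C (fun _ => (n : ℝ) / m)} := by
    intro C hC
    refine I.isCoreset_of_deviation_le hm0 hτ hscale hν0.le hε0.le hνa hνκ fun A hA => ?_
    simp only [Bad, coe_union, Set.mem_compl_iff, Set.mem_union, mem_coe, mem_filter, mem_univ,
      true_and, not_or, not_exists, not_and, not_le] at hC
    have h1 := hC.1 A hA
    have h2 := hC.2 A hA
    rw [abs_le]
    constructor <;> linarith
  refine le_trans ?_ (measure_mono hsub)
  rw [prob_compl_eq_one_sub (Finset.measurableSet _), uniformSample_coe,
    ENNReal.ofReal_sub _ hδ0.le, ENNReal.ofReal_one]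
  gcongr
  rw [div_le_iff₀ (by positivity)]
  have h3 : (#(Bad 1 ∪ Bad (-1)) : ℝ) ≤ #(Bad 1) + #(Bad (-1)) := by
    exact_mod_cast card_union_le _ _
  linarith
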